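/- Let $\Omega\subset\mathbb R^2$ be open, let $2/3<\alpha\le 1$, let $v\in C^{1,\alpha}(\Omega)$ (that is, $v$ is continuously differentiable on $\Omega$ and $\nabla v$ is $\alpha$-Hölder continuous on every compact subset of $\Omega$), and let $U$ be an open set whose closure $\overline U$ is compact and contained in $\Omega$. Let $f$ be the very weak Hessian determinant of $v$, i.e. the distribution on $\Omega$ $$f[\varphi]:=\mathcal{D}et\,\mathcal D^2v[\varphi]:=-\frac12\int_\Omega\Big((\partial_1v)^2\,\partial_{22}\varphi+(\partial_2v)^2\,\partial_{11}\varphi-2\,\partial_1v\,\partial_2v\,\partial_{12}\varphi\Big)\,dx\qquad(\varphi\in C_c^\infty(\Omega)),$$ that is, $f=-\frac12\,\mathrm{curl}\,\mathrm{curl}\,(\nabla v\otimes\nabla v)$. Assume that $f\ge 0$, i.e. $f[\varphi]\ge0$ for every $\varphi\in C_c^\infty(\Omega)$ with $\varphi\ge0$. Then $f$ is induced by a Radon measure $\mu_f$ on $\Omega$, i.e. $\int_\Omega\varphi\,d\mu_f=f[\varphi]$ for all $\varphi\in C_c^\infty(\Omega)$. Write $\deg(\nabla v,U,y)$ for the Brouwer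 degree of $\nabla v|_{\overline U}$ at a point $y\in\mathbb R^2\setminus\nabla v(\partial U)$. Then: (i) for every $y\in\mathbb R^2\setminus\nabla v(\partial U)$, $\deg(\nabla v,U,y)\ge\chi_{\nabla v(U)\setminus\nabla v(\partial U)}(y)$, where $\chi_A$ is the indicator function of $A$; in particular $\deg(\nabla v,U,y)\ge1$ for every $y\in\nabla v(U)\setminus\nabla v(\partial U)$; (ii) $\deg(\nabla v,U,\cdot)\in L^1(\mathbb R^2\setminus\nabla v(\partial U))$ and $$\int_{\mathbb R^2\setminus\nabla v(\partial U)}\deg(\nabla v,U,y)\,dy\le\mu_f(U).$$ -/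

import Mathlib

open Set MeasureTheory TopologicalSpace
open scoped NNReal Distributions LineDeriv ContDiff

noncomputable section

/-- The Euclidean plane. -/
abbrev Plane : Type := EuclideanSpace ℝ (Fin 2)

/-- `U ⋐ Ω`: the closure of `U` is compact and contained in `Ω`. -/
def CompactlyContained (U Ω : Set Plane) : Prop :=
  IsCompact (closure U) ∧ closure U ⊆ Ω

/-- `v ∈ C^{1,α}(Ω)`: `v` is continuously differentiable on the open set `Ω`, and its gradient is
`α`-Hölder continuous on every compact subset of `Ω`. (Values of `v` outside `Ω` are irrelevant.) -/
def IsC1Holder (α : ℝ≥0) (v : Plane → ℝ) (Ω : Opens Plane) : Prop :=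
  ContDiffOn ℝ 1 v Ω ∧
    ∀ K : Set Plane, IsCompact K → K ⊆ Ω → ∃ C : ℝ≥0, HolderOnWith C α (gradient v) K

/-! ### The very weak Hessian determinant -/

/-- The `i`-th coordinate vector of the plane. -/
def coordVec (i : Fin 2) : Plane := EuclideanSpace.single i 1

/-- The distribution `φ ↦ ∫ φ g` on `Ω` given by a locally integrable function `g` on `Ω`. -/
def functionDistribution (Ω : Opens Plane) (g : Plane → ℝ) : 𝓓'(Ω, ℝ) :=
  (TestFunction.integralAgainstBilinCLM (ContinuousLinearMap.mul ℝ ℝ) volume g :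
    𝓓(Ω, ℝ) →L[ℝ] ℝ)

/-- The distribution `curl curl A = ∂₂₂ A₁₁ + ∂₁₁ A₂₂ - ∂₁₂ A₁₂ - ∂₂₁ A₂₁` of a matrix field. -/
def curlCurl (Ω : Opens Plane) (A : Plane → Matrix (Fin 2) (Fin 2) ℝ) : 𝓓'(Ω, ℝ) :=
  ∂_{coordVec 1} (∂_{coordVec 1} (functionDistribution Ω fun x => A x 0 0))
    + ∂_{coordVec 0} (∂_{coordVec 0} (functionDistribution Ω fun x => A x 1 1))
    - ∂_{coordVec 0} (∂_{coordVec 1} (functionDistribution Ω fun x => A x 0 1))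
    - ∂_{coordVec 1} (∂_{coordVec 0} (functionDistribution Ω fun x => A x 1 0))

/-- The very weak Hessian determinant `Det D²v = -½ curl curl (∇v ⊗ ∇v)` on `Ω`. -/
def veryWeakHessianDet (Ω : Opens Plane) (v : Plane → ℝ) : 𝓓'(Ω, ℝ) :=
  (-(1 / 2) : ℝ) • curlCurl Ω fun x => Matrix.of fun i j => gradient v x i * gradient v x j

/-! ### Nonnegative distributions and the Radon measures they induce -/

/-- `f ≥ 0` in the sense of distributions. -/
def DistributionNonneg {Ω : Opens Plane} (f : 𝓓'(Ω, ℝ)) : Prop :=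
  ∀ φ : 𝓓(Ω, ℝ), (∀ x, 0 ≤ φ x) → 0 ≤ f φ

/-- `μ` is a Radon measure on `Ω` (regarded as a measure on the plane carried by `Ω`) with
`∫ φ dμ = f[φ]` for all test functions `φ`. There is at most one such `μ`. -/
structure IsInducedMeasure {Ω : Opens Plane} (f : 𝓓'(Ω, ℝ)) (μ : Measure Plane) : Prop where
  compl_eq_zero : μ (Ω : Set Plane)ᶜ = 0
  lt_top_of_isCompact : ∀ K : Set Plane, IsCompact K → K ⊆ Ω → μ K < ⊤
  integral_eq : ∀ φ : 𝓓(Ω, ℝ), ∫ x, φ x ∂μ = f φ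

open Classical in
/-- The Radon measure `μ_f` induced by a nonnegative distribution `f` (and `0` if `f` is induced by
no Radon measure). -/
def inducedMeasure {Ω : Opens Plane} (f : 𝓓'(Ω, ℝ)) : Measure Plane :=
  if h : ∃ μ, IsInducedMeasure f μ then h.choose else 0

/-! ### The Brouwer degree -/

/-- `w` is a smooth map that may be used to compute the Brouwer degree of `u` on `U` at `y`: on the
closure of `U` it is closer to `u` than the distance from `y` to `u(∂U)`, and `y` is a regular value
of `w` on `U`. -/
structure IsDegreeApprox (u : Plane → Plane) (U : Set Plane) (y : Plane) (w : Plane → Plane) :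
    Prop where
  contDiff : ContDiff ℝ ∞ w
  close : ∀ x ∈ closure U, dist (w x) (u x) < Metric.infDist y (u '' frontier U)
  regular : ∀ x ∈ U, w x = y → (fderiv ℝ w x).det ≠ 0

/-- The degree of a smooth map `w` on `U` at a regular value `y ∉ w(∂U)`: the sum of the signs of
the Jacobian determinants over the (finitely many) preimages of `y` in `U`. -/
def regularDegree (w : Plane → Plane) (U : Set Plane) (y : Plane) : ℤ :=
  ∑ᶠ x ∈ {x | x ∈ U ∧ w x = y}, ((SignType.sign (fderiv ℝ w x).det : SignType) : ℤ)

open Classical in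
/-- The Brouwer degree `deg(u, U, y)` of a map `u`, continuous on the closure of the bounded open
set `U`, at a point `y ∉ u(∂U)`: the degree at `y` of any sufficiently close smooth map having `y`
as a regular value. (The value is `0` by convention where no such map exists, which for `U`
non-empty includes all `y ∈ u(∂U)`.) -/
def brouwerDegree (u : Plane → Plane) (U : Set Plane) (y : Plane) : ℤ :=
  if h : ∃ w, IsDegreeApprox u U y w then regularDegree h.choose U y else 0

end

open Filter Topology Function

/-! ### Smooth cutoff functions -/

/-! The heart of the matter is a local formula. Near y outside ∇v(∂U), for smooth g supported in a
small ball around y and all sufficiently small δ, the field F_δ = ∇v + δ x^⊥ satisfies deg(∇v, U, y)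
∫ g = ∫_U g(F_δ) dμ_f + δ² ∫_U g(F_δ) dx (`IsLocalPotential.exists_degree_formula`).

Both claims follow from it. With δ = 0 the degree is nonnegative, since μ_f is a positive measure.
If y = ∇v(x₀) with x₀ in U, a small δ > 0 makes the last term strictly positive for a bump g, so the
degree, being an integer, is at least 1. With δ = 0 the formula also says that the push-forward of
μ_f restricted to U under ∇v coincides, off ∇v(∂U), with Lebesgue measure weighted by the degree
(`integrableOn_and_integral_eq_of_local`). The integral of the degree is therefore the part of
μ_f(U) not sent into ∇v(∂U).

To prove the formula, mollify ∇v at scale ε and add δ x^⊥, giving a smooth field W_ε. Because the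
Jacobian of a mollified gradient is symmetric, the rotation raises its determinant by exactly δ².
Homotopy invariance expresses the degree as ∫ χ g(W_ε) det DW_ε for a cutoff χ
(`exists_brouwerDegree_mul_integral_eq`). It remains to compare ∫ ψ_ε det D²v_ε, where ψ_ε = χ
g(W_ε), with f[ρ_ε * ψ_ε], which tends to ∫ χ g(F_δ) dμ_f. After one integration by parts the
difference is a commutator of mollification with products, differentiated once and tested against
∇ψ_ε. Such a commutator derivative is O(ε^(2α-1)) by `IsMollifier.abs_pderivPlane_commutator_le`,
and ∇ψ_ε is O(ε^(α-1)). The product O(ε^(3α-2)) vanishes exactly because α > 2/3. -/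

/-- A smooth cutoff function that equals `1` near a compact set and is compactly supported in a
given open neighbourhood of it. -/
theorem exists_smooth_cutoff {K U : Set Plane} (hK : IsCompact K) (hU : IsOpen U) (hKU : K ⊆ U) :
    ∃ χ : Plane → ℝ, ContDiff ℝ ∞ χ ∧ HasCompactSupport χ ∧ tsupport χ ⊆ U ∧
      (∀ x, 0 ≤ χ x ∧ χ x ≤ 1) ∧ ∀ᶠ x in 𝓝ˢ K, χ x = 1 := by
  obtain ⟨L, hL, hKL, hLU⟩ := exists_compact_between hK hU hKU
  obtain ⟨f, h0, h1, h2⟩ := exists_contMDiffMap_zero_one_nhds_of_isClosed (n := ⊤)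
    (modelWithCornersSelf ℝ Plane) (s := (interior L)ᶜ) (t := K) isOpen_interior.isClosed_compl
    hK.isClosed (disjoint_left.2 fun x hx hx' => hx (hKL hx'))
  have hts : tsupport f ⊆ L := by
    refine closure_minimal (fun x hx => ?_) hL.isClosed
    by_contra hxL
    exact hx (h0.self_of_nhdsSet x fun h => hxL (interior_subset h))
  refine ⟨f, f.contMDiff.contDiff, hL.of_isClosed_subset (isClosed_tsupport _) hts,
    hts.trans hLU, fun x => h2 x, h1⟩

/-! ### Nonnegative distributions are induced by Radon measures -/

/-- The restriction of a test function on `Ω` to a compactly supported continuous function. -/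
noncomputable def testFunctionRestrict (Ω : Opens Plane) :
    𝓓(Ω, ℝ) →ₗ[ℝ] CompactlySupportedContinuousMap Ω ℝ where
  toFun φ := ⟨⟨fun x => φ x, φ.continuous.comp continuous_subtype_val⟩, by
    have hc : IsCompact (Subtype.val ⁻¹' tsupport φ : Set Ω) := by
      refine Topology.IsInducing.subtypeVal.isCompact_preimage' φ.hasCompactSupport ?_
      simpa using φ.tsupport_subset
    exact HasCompactSupport.intro hc fun x hx =>
      image_eq_zero_of_notMem_tsupport (f := φ) hx⟩
  map_add' φ ψ := by ext; rfl
  map_smul' c φ := by ext; rfl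

theorem testFunctionRestrict_injective (Ω : Opens Plane) :
    Injective (testFunctionRestrict Ω) := by
  intro φ ψ h
  ext x
  by_cases hx : x ∈ Ω
  · exact DFunLike.congr_fun h ⟨x, hx⟩
  · rw [image_eq_zero_of_notMem_tsupport fun h => hx (φ.tsupport_subset h),
      image_eq_zero_of_notMem_tsupport fun h => hx (ψ.tsupport_subset h)]

/-- The cofinality condition of the M. Riesz extension theorem. A bound for |h| times a cutoff equal
to 1 on the support of h dominates -h. -/
theorem exists_testFunctionRestrict_add_nonneg (Ω : Opens Plane)
    (h : CompactlySupportedContinuousMap Ω ℝ) :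
    ∃ φ : 𝓓(Ω, ℝ), 0 ≤ testFunctionRestrict Ω φ + h := by
  obtain ⟨M, hM⟩ := h.continuous.bounded_above_of_compact_support h.hasCompactSupport
  have hK : IsCompact (Subtype.val '' tsupport h : Set Plane) :=
    h.hasCompactSupport.isCompact.image continuous_subtype_val
  obtain ⟨χ, hχ, hχc, hχs, hχ01, hχ1⟩ := exists_smooth_cutoff hK Ω.isOpen (by
    rintro _ ⟨x, -, rfl⟩; exact x.2)
  refine ⟨M • ⟨χ, hχ, hχc, hχs⟩, fun x => ?_⟩
  change 0 ≤ M * χ x + h x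
  by_cases hx : x ∈ tsupport h
  · rw [hχ1.self_of_nhdsSet _ ⟨x, hx, rfl⟩]
    have : -M ≤ h x ∧ h x ≤ M := abs_le.1 ((Real.norm_eq_abs _).symm.trans_le (hM x))
    linarith
  · rw [image_eq_zero_of_notMem_tsupport hx, add_zero]
    exact mul_nonneg ((norm_nonneg _).trans (hM x)) (hχ01 _).1

/-- A nonnegative distribution is induced by a Radon measure. -/
theorem DistributionNonneg.exists_isInducedMeasure {Ω : Opens Plane} {f : 𝓓'(Ω, ℝ)}
    (hf : DistributionNonneg f) : ∃ μ, IsInducedMeasure f μ := by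
  let R := testFunctionRestrict Ω
  let e := LinearEquiv.ofInjective R (testFunctionRestrict_injective Ω)
  let p : CompactlySupportedContinuousMap Ω ℝ →ₗ.[ℝ] ℝ :=
    ⟨LinearMap.range R, (f : 𝓓(Ω, ℝ) →ₗ[ℝ] ℝ) ∘ₗ e.symm.toLinearMap⟩
  have hpe : ∀ φ, p (e φ) = f φ := fun φ => by
    change f (e.symm (e φ)) = f φ
    rw [e.symm_apply_apply]
  let s : PointedCone ℝ (CompactlySupportedContinuousMap Ω ℝ) :=
    { carrier := {h | ∀ x, 0 ≤ h x}
      add_mem' := fun ha hb x => add_nonneg (ha x) (hb x)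
      zero_mem' := fun _ => le_rfl
      smul_mem' := fun c _ ha x => mul_nonneg c.2 (ha x) }
  -- Positivity on restricted test functions together with cofinality extends f to a positive
  -- functional on C_c(Ω). The Riesz–Markov–Kakutani theorem then represents the extension by a
  -- measure.
  obtain ⟨g, hg, hg0⟩ := riesz_extension s p (by
    intro x hx
    obtain ⟨φ, rfl⟩ := e.surjective x
    rw [hpe]
    refine hf φ fun x => ?_
    by_cases hxΩ : x ∈ Ω
    · exact hx ⟨x, hxΩ⟩
    · rw [image_eq_zero_of_notMem_tsupport fun h => hxΩ (φ.tsupport_subset h)]) (by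
    intro y
    obtain ⟨φ, hφ⟩ := exists_testFunctionRestrict_add_nonneg Ω y
    exact ⟨e φ, hφ⟩)
  have : LocallyCompactSpace Ω := Ω.isOpen.locallyCompactSpace
  let Λ : CompactlySupportedContinuousMap Ω ℝ →ₚ[ℝ] ℝ := PositiveLinearMap.mk₀ g hg0
  have hm : MeasurableEmbedding (Subtype.val : Ω → Plane) :=
    MeasurableEmbedding.subtype_coe Ω.isOpen.measurableSet
  refine ⟨(RealRMK.rieszMeasure Λ).map Subtype.val, ?_, ?_, ?_⟩
  · rw [hm.map_apply]
    have : (Subtype.val ⁻¹' (Ω : Set Plane)ᶜ : Set Ω) = ∅ := by ext x; simp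
    rw [this, measure_empty]
  · intro K hK hKΩ
    rw [hm.map_apply]
    refine IsCompact.measure_lt_top ?_
    exact Topology.IsInducing.subtypeVal.isCompact_preimage' hK (by simpa using hKΩ)
  · intro φ
    rw [hm.integral_map]
    have := RealRMK.integral_rieszMeasure Λ (R φ)
    refine this.trans ?_
    change g (R φ) = f φ
    rw [← hpe φ, ← hg]
    rfl

theorem DistributionNonneg.isInducedMeasure_inducedMeasure {Ω : Opens Plane} {f : 𝓓'(Ω, ℝ)}
    (hf : DistributionNonneg f) : IsInducedMeasure f (inducedMeasure f) := by
  have h := hf.exists_isInducedMeasure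
  rw [inducedMeasure, dif_pos h]
  exact h.choose_spec

/-! ### Partial derivatives in the plane -/

/-- The partial derivative of a scalar function in the `i`-th coordinate direction. -/
noncomputable def pderivPlane (i : Fin 2) (f : Plane → ℝ) (x : Plane) : ℝ :=
  fderiv ℝ f x (coordVec i)

theorem gradient_apply_eq_pderivPlane (v : Plane → ℝ) (x : Plane) (i : Fin 2) :
    gradient v x i = pderivPlane i v x := by
  have h : inner ℝ (gradient v x) (coordVec i) = fderiv ℝ v x (coordVec i) := by
    rw [gradient, InnerProductSpace.toDual_symm_apply]
  rw [pderivPlane, ← h, coordVec, EuclideanSpace.inner_single_right]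
  simp

theorem contDiff_pderivPlane {f : Plane → ℝ} (hf : ContDiff ℝ ∞ f) (i : Fin 2) :
    ContDiff ℝ ∞ (pderivPlane i f) :=
  (hf.fderiv_right (m := ∞) (by simp)).clm_apply contDiff_const

theorem continuous_pderivPlane {f : Plane → ℝ} (hf : ContDiff ℝ 1 f) (i : Fin 2) :
    Continuous (pderivPlane i f) :=
  (hf.continuous_fderiv one_ne_zero).clm_apply continuous_const

theorem tsupport_pderivPlane_subset (f : Plane → ℝ) (i : Fin 2) :
    tsupport (pderivPlane i f) ⊆ tsupport f :=
  tsupport_fderiv_apply_subset ℝ (coordVec i)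

theorem HasCompactSupport.pderivPlane {f : Plane → ℝ} (hf : HasCompactSupport f) (i : Fin 2) :
    HasCompactSupport (pderivPlane i f) :=
  hf.fderiv_apply (𝕜 := ℝ) (coordVec i)

theorem pderivPlane_comm {f : Plane → ℝ} (hf : ContDiff ℝ ∞ f) (i j : Fin 2) (x : Plane) :
    pderivPlane i (pderivPlane j f) x = pderivPlane j (pderivPlane i f) x := by
  have h2 : ContDiffAt ℝ 2 f x := (contDiff_infty.1 hf 2).contDiffAt
  have hs := h2.isSymmSndFDerivAt (by simp)
  have hd : DifferentiableAt ℝ (fderiv ℝ f) x :=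
    ((hf.fderiv_right (m := ∞) (by simp)).differentiable (by simp)).differentiableAt
  have key : ∀ k l : Fin 2, _root_.pderivPlane k (_root_.pderivPlane l f) x
      = fderiv ℝ (fderiv ℝ f) x (coordVec k) (coordVec l) := by
    intro k l
    have := (hd.hasFDerivAt.clm_apply (hasFDerivAt_const (coordVec l) x)).fderiv
    change fderiv ℝ (fun x => fderiv ℝ f x (coordVec l)) x (coordVec k) = _
    rw [this]
    simp
  rw [key, key]
  exact hs _ _

theorem lineDeriv_testFunction_apply {Ω : Opens Plane} (φ : 𝓓(Ω, ℝ)) (i : Fin 2) :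
    ⇑(∂_{coordVec i} φ : 𝓓(Ω, ℝ)) = pderivPlane i φ := by
  ext x
  rw [TestFunction.lineDerivOp_eq_lineDerivCLM ℝ, TestFunction.lineDerivCLM_apply_of_le (by simp),
    pderivPlane, (φ.contDiff.differentiable (by simp)).differentiableAt.lineDeriv_eq_fderiv]

theorem functionDistribution_apply {Ω : Opens Plane} {g : Plane → ℝ} (hg : ContinuousOn g Ω)
    (φ : 𝓓(Ω, ℝ)) : functionDistribution Ω g φ = ∫ x, φ x * g x := by
  have h : LocallyIntegrableOn g Ω := hg.locallyIntegrableOn Ω.isOpen.measurableSet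
  exact TestFunction.integralAgainstBilinCLM_eq_integral h

/-- The very weak Hessian determinant evaluated at a test function, with the gradient replaced by
any field `(a, b)` that agrees with it on the support of the test function. -/
theorem veryWeakHessianDet_apply {Ω : Opens Plane} {v : Plane → ℝ}
    (hv : ContinuousOn (gradient v) Ω) {a b : Plane → ℝ} (φ : 𝓓(Ω, ℝ))
    (ha : ∀ x ∈ tsupport φ, a x = gradient v x 0) (hb : ∀ x ∈ tsupport φ, b x = gradient v x 1) :
    veryWeakHessianDet Ω v φ = -(1 / 2) *
      ((∫ x, a x * a x * pderivPlane 1 (pderivPlane 1 φ) x)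
        + (∫ x, b x * b x * pderivPlane 0 (pderivPlane 0 φ) x)
        - (∫ x, a x * b x * pderivPlane 1 (pderivPlane 0 φ) x)
        - ∫ x, a x * b x * pderivPlane 0 (pderivPlane 1 φ) x) := by
  have hc : ∀ i : Fin 2, ContinuousOn (fun x => gradient v x i) Ω := fun i =>
    (EuclideanSpace.proj i : Plane →L[ℝ] ℝ).continuous.comp_continuousOn hv
  have key : ∀ (i j k l : Fin 2) (p q : Plane → ℝ), (∀ x ∈ tsupport φ, p x = gradient v x i) →
      (∀ x ∈ tsupport φ, q x = gradient v x j) →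
      (∂_{coordVec k} (∂_{coordVec l} (functionDistribution Ω
        fun x => gradient v x i * gradient v x j))) φ
        = ∫ x, p x * q x * pderivPlane l (pderivPlane k φ) x := by
    intro i j k l p q hp hq
    rw [Distribution.lineDerivOp_apply_apply, map_neg, Distribution.lineDerivOp_apply_apply,
      map_neg, neg_neg, functionDistribution_apply (g := fun x => gradient v x i * gradient v x j)
        ((hc i).mul (hc j))]
    refine integral_congr_ae (ae_of_all _ fun x => ?_)
    simp only [lineDeriv_testFunction_apply]
    by_cases hx : x ∈ tsupport φ
    · rw [hp x hx, hq x hx]; ring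
    · rw [image_eq_zero_of_notMem_tsupport fun h => hx (tsupport_pderivPlane_subset _ _
        (tsupport_pderivPlane_subset _ _ h))]
      ring
  have e : veryWeakHessianDet Ω v φ = -(1 / 2) *
      ((∂_{coordVec 1} (∂_{coordVec 1} (functionDistribution Ω
          fun x => gradient v x 0 * gradient v x 0))) φ
        + (∂_{coordVec 0} (∂_{coordVec 0} (functionDistribution Ω
          fun x => gradient v x 1 * gradient v x 1))) φ
        - (∂_{coordVec 0} (∂_{coordVec 1} (functionDistribution Ω
          fun x => gradient v x 0 * gradient v x 1))) φ
        - (∂_{coordVec 1} (∂_{coordVec 0} (functionDistribution Ω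
          fun x => gradient v x 1 * gradient v x 0))) φ) := rfl
  rw [e, key 0 0 1 1 a a ha ha, key 1 1 0 0 b b hb hb, key 0 1 0 1 a b ha hb,
    key 1 0 1 0 b a hb ha]
  simp only [mul_comm (b _) (a _)]

/-! ### Mollification -/

/-- The convolution of `h` with the kernel `ρ`. -/
noncomputable def mollify (ρ h : Plane → ℝ) (x : Plane) : ℝ := ∫ t, ρ t * h (x - t)

/-- `ρ` is a standard mollifier of radius `ε`, whose gradient has mean size at most `C / ε`. -/
structure IsMollifier (ρ : Plane → ℝ) (ε C : ℝ) : Prop where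
  contDiff : ContDiff ℝ ∞ ρ
  nonneg : ∀ x, 0 ≤ ρ x
  even : ∀ x, ρ (-x) = ρ x
  support_subset : support ρ ⊆ Metric.ball 0 ε
  integral_eq_one : ∫ x, ρ x = 1
  integral_abs_pderivPlane_le : ∀ i, ∫ x, |pderivPlane i ρ x| ≤ C / ε

theorem exists_isMollifier :
    ∃ C : ℝ, 0 ≤ C ∧ ∀ ε : ℝ, 0 < ε → ∃ ρ, IsMollifier ρ ε C := by
  let b : ContDiffBump (0 : Plane) := ⟨1 / 2, 1, by norm_num, by norm_num⟩
  let σ : Plane → ℝ := b.normed volume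
  have hσ : ContDiff ℝ ∞ σ := b.contDiff_normed
  let I : Fin 2 → ℝ := fun i => ∫ x, |pderivPlane i σ x|
  have hI : ∀ i, 0 ≤ I i := fun i => integral_nonneg fun x => abs_nonneg _
  refine ⟨I 0 + I 1, add_nonneg (hI 0) (hI 1), fun ε hε => ?_⟩
  have hε0 := hε.ne'
  -- This dilation preserves mass in dimension two and multiplies the L¹ norm of each partial
  -- derivative by 1/ε. Adding the two norms for σ gives one constant for both directions.
  let ρ : Plane → ℝ := fun x => (ε ^ 2)⁻¹ * σ (ε⁻¹ • x)
  have scale : ∀ f : Plane → ℝ, ∫ x, f (ε⁻¹ • x) = ε ^ 2 * ∫ x, f x := by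
    intro f
    rw [Measure.integral_comp_smul, finrank_euclideanSpace_fin, inv_pow, inv_inv,
      abs_of_pos (by positivity), smul_eq_mul]
  have hpd : ∀ i x, pderivPlane i ρ x = (ε ^ 2)⁻¹ * (ε⁻¹ * pderivPlane i σ (ε⁻¹ • x)) := by
    intro i x
    have h1 : HasFDerivAt (fun x : Plane => ε⁻¹ • x) (ε⁻¹ • ContinuousLinearMap.id ℝ Plane) x :=
      (hasFDerivAt_id x).const_smul ε⁻¹
    have h2 := ((hσ.differentiable (by simp)).differentiableAt (x := ε⁻¹ • x)).hasFDerivAt.comp x h1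
    have h3 := (h2.const_mul (ε ^ 2)⁻¹).fderiv
    change fderiv ℝ (fun x => (ε ^ 2)⁻¹ * σ (ε⁻¹ • x)) x (coordVec i) = _
    change fderiv ℝ (fun x => (ε ^ 2)⁻¹ * σ (ε⁻¹ • x)) x = _ at h3
    rw [h3]
    simp [pderivPlane]
  refine ⟨ρ, ?_, ?_, ?_, ?_, ?_, ?_⟩
  · exact contDiff_const.mul (hσ.comp (contDiff_const_smul _))
  · exact fun x => mul_nonneg (by positivity) (b.nonneg_normed _)
  · intro x
    change _ * σ (ε⁻¹ • -x) = _ * σ (ε⁻¹ • x)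
    rw [smul_neg]
    congr 1
    exact b.normed_neg _
  · intro x hx
    have hx' : ε⁻¹ • x ∈ support σ := fun h => hx (by change _ * σ _ = 0; rw [h, mul_zero])
    rw [b.support_normed_eq, mem_ball_zero_iff, norm_smul, Real.norm_of_nonneg (by positivity),
      inv_mul_lt_iff₀ hε] at hx'
    simpa [b] using hx'
  · change ∫ x, (ε ^ 2)⁻¹ * σ (ε⁻¹ • x) = 1
    rw [integral_const_mul, scale, b.integral_normed, mul_one, inv_mul_cancel₀ (by positivity)]
  · intro i
    simp only [hpd, abs_mul, abs_of_pos (inv_pos.2 hε), abs_of_pos (inv_pos.2 (pow_pos hε 2))]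
    rw [integral_const_mul, integral_const_mul, scale fun x => |pderivPlane i σ x|]
    have : I i ≤ I 0 + I 1 := by
      fin_cases i
      · exact le_add_of_nonneg_right (hI 1)
      · exact le_add_of_nonneg_left (hI 0)
    calc (ε ^ 2)⁻¹ * (ε⁻¹ * (ε ^ 2 * I i)) = I i / ε := by field_simp
      _ ≤ (I 0 + I 1) / ε := by gcongr

section Mollify

open ContinuousLinearMap (lsmul)
open scoped Convolution

variable {ρ h k : Plane → ℝ}

theorem mollify_eq_convolution (ρ h : Plane → ℝ) :
    mollify ρ h = (ρ ⋆[lsmul ℝ ℝ, volume] h) := rfl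

theorem mollify_eq_swap (ρ h : Plane → ℝ) (x : Plane) :
    mollify ρ h x = ∫ t, ρ (x - t) * h t := by
  rw [mollify, ← integral_sub_left_eq_self _ volume x]
  simp

theorem contDiff_mollify (hρ : ContDiff ℝ ∞ ρ) (hρc : HasCompactSupport ρ) (hh : Continuous h) :
    ContDiff ℝ ∞ (mollify ρ h) :=
  hρc.contDiff_convolution_left (n := ⊤) (lsmul ℝ ℝ) hρ
    (hh.locallyIntegrable (μ := (volume : Measure Plane)))

theorem hasCompactSupport_mollify (hρc : HasCompactSupport ρ) (hh : HasCompactSupport h) :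
    HasCompactSupport (mollify ρ h) :=
  HasCompactSupport.convolution (lsmul ℝ ℝ) (μ := (volume : Measure Plane)) hρc hh

theorem integrable_mollify_integrand (hρ : Continuous ρ) (hρc : HasCompactSupport ρ)
    (hh : Continuous h) (x : Plane) : Integrable fun t => ρ t * h (x - t) :=
  (hρ.mul (hh.comp (by fun_prop))).integrable_of_hasCompactSupport hρc.mul_right

theorem pderivPlane_mollify (hρ : ContDiff ℝ ∞ ρ) (hρc : HasCompactSupport ρ) (hh : Continuous h)
    (i : Fin 2) (x : Plane) :
    pderivPlane i (mollify ρ h) x = mollify (pderivPlane i ρ) h x := by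
  have h1 := (hρc.hasFDerivAt_convolution_left (lsmul ℝ ℝ) (hρ.of_le (by simp))
    (hh.locallyIntegrable (μ := volume)) x).fderiv
  rw [pderivPlane, mollify_eq_convolution, h1, convolution_def, ContinuousLinearMap.integral_apply]
  · rfl
  · exact (hρc.fderiv ℝ).convolutionExists_left _ (hρ.continuous_fderiv (by simp))
      hh.locallyIntegrable x

/-- The derivative falls on h instead of the kernel. Hence a mollified gradient is again a gradient,
and its Jacobian is symmetric. -/
theorem pderivPlane_mollify_right (hρ : Continuous ρ) (hh : ContDiff ℝ 1 h)
    (hhc : HasCompactSupport h) (i : Fin 2) (x : Plane) :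
    pderivPlane i (mollify ρ h) x = mollify ρ (pderivPlane i h) x := by
  have h1 := (hhc.hasFDerivAt_convolution_right (lsmul ℝ ℝ)
    (hρ.locallyIntegrable (μ := volume)) hh x).fderiv
  rw [pderivPlane, mollify_eq_convolution, h1, convolution_def, ContinuousLinearMap.integral_apply]
  · rfl
  · exact (hhc.fderiv ℝ).convolutionExists_right _ hρ.locallyIntegrable
      (hh.continuous_fderiv one_ne_zero) x

/-- Mollification by an even kernel is self-adjoint, by Fubini. This transfers it from the test
function to the products of first derivatives. -/
theorem integral_mollify_mul (hρ : Continuous ρ) (heven : ∀ x, ρ (-x) = ρ x) (hh : Continuous h)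
    (hhc : HasCompactSupport h) (hk : Continuous k) (hkc : HasCompactSupport k) :
    ∫ x, mollify ρ h x * k x = ∫ x, h x * mollify ρ k x := by
  simp only [mollify_eq_swap, ← integral_mul_const, ← integral_const_mul]
  rw [integral_integral_swap_of_hasCompactSupport]
  · refine integral_congr_ae (ae_of_all _ fun y => integral_congr_ae (ae_of_all _ fun x => ?_))
    change ρ (x - y) * h y * k x = h y * (ρ (y - x) * k x)
    rw [← neg_sub y x, heven]
    ring
  · fun_prop
  · refine HasCompactSupport.intro (hkc.isCompact.prod hhc.isCompact) fun p hp => ?_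
    rw [mem_prod, not_and_or] at hp
    rcases hp with hp | hp
    · change _ * k p.1 = 0
      rw [image_eq_zero_of_notMem_tsupport hp, mul_zero]
    · change _ * h p.2 * _ = 0
      rw [image_eq_zero_of_notMem_tsupport hp, mul_zero, zero_mul]

end Mollify

namespace IsMollifier

variable {ρ h : Plane → ℝ} {ε C : ℝ}

theorem hasCompactSupport (hρ : IsMollifier ρ ε C) : HasCompactSupport ρ :=
  HasCompactSupport.of_support_subset_isCompact (isCompact_closedBall 0 ε)
    (hρ.support_subset.trans Metric.ball_subset_closedBall)

theorem continuous (hρ : IsMollifier ρ ε C) : Continuous ρ := hρ.contDiff.continuous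

theorem abs_mollify_sub_le (hρ : IsMollifier ρ ε C) (hh : Continuous h) {x : Plane} {c B : ℝ}
    (hB : 0 ≤ B) (hx : ∀ z ∈ Metric.ball x ε, |h z - c| ≤ B) : |mollify ρ h x - c| ≤ B :=
  dist_convolution_le (E' := ℝ) (μ := (volume : Measure Plane)) hB hρ.support_subset hρ.nonneg hρ.integral_eq_one
    hh.aestronglyMeasurable hx

theorem abs_pderivPlane_mollify_le' (hρ : IsMollifier ρ ε C) {i : Fin 2} {x : Plane} {B : ℝ}
    (hB : 0 ≤ B) (hx : ∀ z ∈ Metric.closedBall x ε, |h z| ≤ B) :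
    |mollify (pderivPlane i ρ) h x| ≤ C / ε * B := by
  have hint : Integrable fun t => |pderivPlane i ρ t| :=
    ((contDiff_pderivPlane hρ.contDiff i).continuous.integrable_of_hasCompactSupport
      (hρ.hasCompactSupport.pderivPlane i)).abs
  calc |mollify (pderivPlane i ρ) h x| ≤ ∫ t, |pderivPlane i ρ t| * B := by
        rw [mollify, ← Real.norm_eq_abs]
        refine norm_integral_le_of_norm_le (hint.mul_const B) (ae_of_all _ fun t => ?_)
        rw [Real.norm_eq_abs, abs_mul]
        by_cases ht : t ∈ Metric.closedBall (0 : Plane) ε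
        · refine mul_le_mul_of_nonneg_left (hx _ ?_) (abs_nonneg _)
          simpa [dist_eq_norm] using ht
        · have : t ∉ tsupport (pderivPlane i ρ) := fun h => ht
            (closure_minimal (hρ.support_subset.trans Metric.ball_subset_closedBall)
              Metric.isClosed_closedBall (tsupport_pderivPlane_subset _ _ h))
          rw [image_eq_zero_of_notMem_tsupport this]
          simp
    _ = (∫ t, |pderivPlane i ρ t|) * B := integral_mul_const _ _
    _ ≤ C / ε * B := mul_le_mul_of_nonneg_right (hρ.integral_abs_pderivPlane_le i) hB

theorem mollify_const (hρ : IsMollifier ρ ε C) (c x) : mollify ρ (fun _ => c) x = c := by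
  rw [mollify, integral_mul_const, hρ.integral_eq_one, one_mul]

theorem mollify_pderivPlane_const (hρ : IsMollifier ρ ε C) (i : Fin 2) (c x) :
    mollify (pderivPlane i ρ) (fun _ => c) x = 0 := by
  rw [← pderivPlane_mollify hρ.contDiff hρ.hasCompactSupport continuous_const]
  have : mollify ρ (fun _ => c) = fun _ => c := funext fun x => hρ.mollify_const c x
  rw [this, pderivPlane]
  simp

/-- The kernel's derivative has mean zero, so a constant may be subtracted from h and only its
oscillation at scale ε enters. -/
theorem abs_pderivPlane_mollify_le (hρ : IsMollifier ρ ε C) (hh : Continuous h) {i : Fin 2}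
    {x : Plane} {c B : ℝ} (hB : 0 ≤ B) (hx : ∀ z ∈ Metric.closedBall x ε, |h z - c| ≤ B) :
    |pderivPlane i (mollify ρ h) x| ≤ C / ε * B := by
  rw [pderivPlane_mollify hρ.contDiff hρ.hasCompactSupport hh]
  have hcont := (contDiff_pderivPlane hρ.contDiff i).continuous
  have hcs := hρ.hasCompactSupport.pderivPlane i
  have e : mollify (pderivPlane i ρ) h x = mollify (pderivPlane i ρ) (fun z => h z - c) x := by
    have h0 := hρ.mollify_pderivPlane_const i c x
    simp only [mollify, mul_sub] at h0 ⊢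
    rw [integral_sub (integrable_mollify_integrand hcont hcs hh x)
      (integrable_mollify_integrand hcont hcs continuous_const x), h0, sub_zero]
  rw [e]
  exact hρ.abs_pderivPlane_mollify_le' hB hx

/-- The commutator estimate: mollification and products commute up to a quadratic error. -/
theorem abs_pderivPlane_commutator_le (hρ : IsMollifier ρ ε C) {a b : Plane → ℝ}
    (ha : Continuous a) (hb : Continuous b) {i : Fin 2} {x : Plane} {B : ℝ} (hB : 0 ≤ B)
    (hax : ∀ z ∈ Metric.closedBall x ε, |a z - a x| ≤ B)
    (hbx : ∀ z ∈ Metric.closedBall x ε, |b z - b x| ≤ B) :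
    |pderivPlane i (mollify ρ fun z => a z * b z) x
      - pderivPlane i (fun z => mollify ρ a z * mollify ρ b z) x| ≤ 3 * (C / ε * B * B) := by
  have hcont := (contDiff_pderivPlane hρ.contDiff i).continuous
  have hcs := hρ.hasCompactSupport.pderivPlane i
  have hd : ∀ {h : Plane → ℝ}, Continuous h → DifferentiableAt ℝ (mollify ρ h) x := fun hh =>
    ((contDiff_mollify hρ.contDiff hρ.hasCompactSupport hh).differentiable (by simp)).differentiableAt
  have hprod : pderivPlane i (fun z => mollify ρ a z * mollify ρ b z) x
      = mollify ρ a x * pderivPlane i (mollify ρ b) x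
        + mollify ρ b x * pderivPlane i (mollify ρ a) x := by
    have := (hd ha).hasFDerivAt.mul (hd hb).hasFDerivAt
    change fderiv ℝ (mollify ρ a * mollify ρ b) x (coordVec i) = _
    rw [this.fderiv]
    rfl
  -- Expand (a - a(x))(b - b(x)); its constant term disappears because the derivative of ρ has mean
  -- zero.
  have hsplit : pderivPlane i (mollify ρ fun z => a z * b z) x
      = mollify (pderivPlane i ρ) (fun z => (a z - a x) * (b z - b x)) x
        + a x * pderivPlane i (mollify ρ b) x + b x * pderivPlane i (mollify ρ a) x := by
    rw [pderivPlane_mollify hρ.contDiff hρ.hasCompactSupport (h := fun z => a z * b z) (ha.mul hb),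
      pderivPlane_mollify hρ.contDiff hρ.hasCompactSupport ha,
      pderivPlane_mollify hρ.contDiff hρ.hasCompactSupport hb]
    have h0 := hρ.mollify_pderivPlane_const i (a x * b x) x
    have I := fun {h : Plane → ℝ} (hh : Continuous h) =>
      integrable_mollify_integrand hcont hcs hh x
    have I1 := I (h := fun z => (a z - a x) * (b z - b x)) (by fun_prop)
    have I2 := (I hb).const_mul (a x)
    have I3 := (I ha).const_mul (b x)
    have I4 := I (h := fun _ => a x * b x) continuous_const
    have I12 : Integrable fun t => pderivPlane i ρ t * ((a (x - t) - a x) * (b (x - t) - b x))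
        + a x * (pderivPlane i ρ t * b (x - t)) := I1.add I2
    have I123 : Integrable fun t => pderivPlane i ρ t * ((a (x - t) - a x) * (b (x - t) - b x))
        + a x * (pderivPlane i ρ t * b (x - t)) + b x * (pderivPlane i ρ t * a (x - t)) :=
      I12.add I3
    have e : mollify (pderivPlane i ρ) (fun z => a z * b z) x
        = mollify (pderivPlane i ρ) (fun z => (a z - a x) * (b z - b x)) x
          + a x * mollify (pderivPlane i ρ) b x + b x * mollify (pderivPlane i ρ) a x
          - mollify (pderivPlane i ρ) (fun _ => a x * b x) x := by
      simp only [mollify]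
      rw [← integral_const_mul, ← integral_const_mul, ← integral_add I1 I2,
        ← integral_add I12 I3, ← integral_sub I123 I4]
      refine integral_congr_ae (ae_of_all _ fun t => ?_)
      ring
    rw [e, h0, sub_zero]
  have hball : ∀ {h : Plane → ℝ}, (∀ z ∈ Metric.closedBall x ε, |h z - h x| ≤ B) →
      ∀ z ∈ Metric.ball x ε, |h z - h x| ≤ B := fun hh z hz =>
    hh z (Metric.ball_subset_closedBall hz)
  have e1 := hρ.abs_pderivPlane_mollify_le' (i := i) (x := x)
    (h := fun z => (a z - a x) * (b z - b x)) (B := B * B) (mul_nonneg hB hB) fun z hz => by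
      rw [abs_mul]; exact mul_le_mul (hax z hz) (hbx z hz) (abs_nonneg _) hB
  have e2 := hρ.abs_pderivPlane_mollify_le (i := i) ha hB hax
  have e3 := hρ.abs_pderivPlane_mollify_le (i := i) hb hB hbx
  have e4 := hρ.abs_mollify_sub_le ha hB (hball hax)
  have e5 := hρ.abs_mollify_sub_le hb hB (hball hbx)
  have hD : 0 ≤ C / ε * B := (abs_nonneg _).trans e2
  rw [hsplit, hprod]
  set P := mollify (pderivPlane i ρ) (fun z => (a z - a x) * (b z - b x)) x
  set pa := pderivPlane i (mollify ρ a) x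
  set pb := pderivPlane i (mollify ρ b) x
  have e6 : |pb * (mollify ρ a x - a x)| ≤ C / ε * B * B := by
    rw [abs_mul]; exact mul_le_mul e3 e4 (abs_nonneg _) hD
  have e7 : |pa * (mollify ρ b x - b x)| ≤ C / ε * B * B := by
    rw [abs_mul]; exact mul_le_mul e2 e5 (abs_nonneg _) hD
  -- After regrouping, each derivative of size (C/ε)B is multiplied by a mollification error of size
  -- B. Every one of the three terms is thus quadratic in the oscillation.
  have e8 : P + a x * pb + b x * pa - (mollify ρ a x * pb + mollify ρ b x * pa)
      = P - pb * (mollify ρ a x - a x) - pa * (mollify ρ b x - b x) := by ring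
  rw [e8]
  rw [abs_le] at *
  constructor <;> nlinarith

end IsMollifier

/-! ### Calculus of partial derivatives -/

section Pderiv

variable {f g : Plane → ℝ} {x : Plane} {i : Fin 2}

theorem pderivPlane_add (hf : DifferentiableAt ℝ f x) (hg : DifferentiableAt ℝ g x) :
    pderivPlane i (fun z => f z + g z) x = pderivPlane i f x + pderivPlane i g x := by
  change fderiv ℝ (f + g) x (coordVec i) = _
  rw [(hf.hasFDerivAt.add hg.hasFDerivAt).fderiv]
  rfl

theorem pderivPlane_sub (hf : DifferentiableAt ℝ f x) (hg : DifferentiableAt ℝ g x) :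
    pderivPlane i (fun z => f z - g z) x = pderivPlane i f x - pderivPlane i g x := by
  change fderiv ℝ (f - g) x (coordVec i) = _
  rw [(hf.hasFDerivAt.sub hg.hasFDerivAt).fderiv]
  rfl

theorem pderivPlane_mul (hf : DifferentiableAt ℝ f x) (hg : DifferentiableAt ℝ g x) :
    pderivPlane i (fun z => f z * g z) x = f x * pderivPlane i g x + g x * pderivPlane i f x := by
  change fderiv ℝ (f * g) x (coordVec i) = _
  rw [(hf.hasFDerivAt.mul hg.hasFDerivAt).fderiv]
  rfl

theorem pderivPlane_const_mul (c : ℝ) (hf : DifferentiableAt ℝ f x) :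
    pderivPlane i (fun z => c * f z) x = c * pderivPlane i f x := by
  rw [pderivPlane_mul (differentiableAt_const c) hf]
  simp [pderivPlane]

theorem plane_eq_sum_coordVec (y : Plane) : y = y 0 • coordVec 0 + y 1 • coordVec 1 := by
  ext j
  fin_cases j <;> simp [coordVec]

theorem fderiv_apply_eq_pderivPlane (g : Plane → ℝ) (x y : Plane) :
    fderiv ℝ g x y = pderivPlane 0 g x * y 0 + pderivPlane 1 g x * y 1 := by
  conv_lhs => rw [plane_eq_sum_coordVec y]
  simp only [map_add, map_smul, smul_eq_mul, pderivPlane]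
  ring

theorem fderiv_coordVec_apply {w : Plane → Plane} (hw : DifferentiableAt ℝ w x) (i j : Fin 2) :
    fderiv ℝ w x (coordVec i) j = pderivPlane i (fun z => w z j) x := by
  have := ((EuclideanSpace.proj j : Plane →L[ℝ] ℝ).hasFDerivAt.comp x hw.hasFDerivAt).fderiv
  change _ = fderiv ℝ ((EuclideanSpace.proj j : Plane →L[ℝ] ℝ) ∘ w) x (coordVec i)
  rw [this]
  rfl

theorem pderivPlane_comp {w : Plane → Plane} (hg : DifferentiableAt ℝ g (w x))
    (hw : DifferentiableAt ℝ w x) :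
    pderivPlane i (fun z => g (w z)) x = pderivPlane 0 g (w x) * pderivPlane i (fun z => w z 0) x
      + pderivPlane 1 g (w x) * pderivPlane i (fun z => w z 1) x := by
  have := (hg.hasFDerivAt.comp x hw.hasFDerivAt).fderiv
  change fderiv ℝ (g ∘ w) x (coordVec i) = _
  rw [this, ContinuousLinearMap.comp_apply, fderiv_apply_eq_pderivPlane, fderiv_coordVec_apply hw,
    fderiv_coordVec_apply hw]

theorem det_fderiv_plane {w : Plane → Plane} (hw : DifferentiableAt ℝ w x) :
    (fderiv ℝ w x).det = pderivPlane 0 (fun z => w z 0) x * pderivPlane 1 (fun z => w z 1) x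
      - pderivPlane 1 (fun z => w z 0) x * pderivPlane 0 (fun z => w z 1) x := by
  rw [ContinuousLinearMap.det, ← LinearMap.det_toMatrix (EuclideanSpace.basisFun (Fin 2) ℝ).toBasis,
    Matrix.det_fin_two]
  simp only [LinearMap.toMatrix_apply, OrthonormalBasis.coe_toBasis, EuclideanSpace.basisFun_apply,
    OrthonormalBasis.coe_toBasis_repr_apply, EuclideanSpace.basisFun_repr,
    ContinuousLinearMap.coe_coe, ← fderiv_coordVec_apply hw]
  rfl

theorem contDiff_coord {w : Plane → Plane} (hw : ContDiff ℝ ∞ w) (j : Fin 2) :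
    ContDiff ℝ ∞ fun z => w z j :=
  (EuclideanSpace.proj j : Plane →L[ℝ] ℝ).contDiff.comp hw

theorem integral_mul_pderivPlane (hf : ContDiff ℝ 1 f) (hfc : HasCompactSupport f)
    (hg : ContDiff ℝ 1 g) (i : Fin 2) :
    ∫ x, f x * pderivPlane i g x = -∫ x, pderivPlane i f x * g x := by
  refine integral_mul_fderiv_eq_neg_fderiv_mul_of_integrable (𝕜 := ℝ) ?_ ?_ ?_
    (fun x _ => (hf.differentiable one_ne_zero).differentiableAt)
    (fun x _ => (hg.differentiable one_ne_zero).differentiableAt)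
  · exact ((continuous_pderivPlane hf i).mul hg.continuous).integrable_of_hasCompactSupport
      (hfc.pderivPlane i).mul_right
  · exact (hf.continuous.mul (continuous_pderivPlane hg i)).integrable_of_hasCompactSupport
      hfc.mul_right
  · exact (hf.continuous.mul hg.continuous).integrable_of_hasCompactSupport hfc.mul_right

end Pderiv

/-! ### Homotopy invariance of the degree integral -/

section Homotopy

variable {g χ : Plane → ℝ}

/-- The first variation of `g(w) det Dw` in the direction `h` is a divergence. -/
theorem div_degree_field {w h : Plane → Plane} (hg : ContDiff ℝ ∞ g) (hw : ContDiff ℝ ∞ w)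
    (hh : ContDiff ℝ ∞ h) (x : Plane) :
    pderivPlane 0 (fun z => g (w z) * (h z 0 * pderivPlane 1 (fun z => w z 1) z
        - h z 1 * pderivPlane 1 (fun z => w z 0) z)) x
      + pderivPlane 1 (fun z => g (w z) * (h z 1 * pderivPlane 0 (fun z => w z 0) z
        - h z 0 * pderivPlane 0 (fun z => w z 1) z)) x
    = fderiv ℝ g (w x) (h x) * (fderiv ℝ w x).det
      + g (w x) * (pderivPlane 0 (fun z => h z 0) x * pderivPlane 1 (fun z => w z 1) x
        + pderivPlane 0 (fun z => w z 0) x * pderivPlane 1 (fun z => h z 1) x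
        - pderivPlane 1 (fun z => h z 0) x * pderivPlane 0 (fun z => w z 1) x
        - pderivPlane 1 (fun z => w z 0) x * pderivPlane 0 (fun z => h z 1) x) := by
  have D : ∀ {f : Plane → ℝ}, ContDiff ℝ ∞ f → ∀ x, DifferentiableAt ℝ f x := fun hf x =>
    (hf.differentiable (by simp)).differentiableAt
  have hw0 := contDiff_coord hw 0
  have hw1 := contDiff_coord hw 1
  have hh0 := contDiff_coord hh 0
  have hh1 := contDiff_coord hh 1
  have hgw : ContDiff ℝ ∞ fun z => g (w z) := hg.comp hw
  have hwd : DifferentiableAt ℝ w x := (hw.differentiable (by simp)).differentiableAt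
  have q : ∀ j k, ContDiff ℝ ∞ fun z => pderivPlane j (fun z => w z k) z :=
    fun j k => contDiff_pderivPlane (contDiff_coord hw k) j
  rw [pderivPlane_mul (D hgw x) (D ((hh0.mul (q 1 1)).sub (hh1.mul (q 1 0))) x),
    pderivPlane_mul (D hgw x) (D ((hh1.mul (q 0 0)).sub (hh0.mul (q 0 1))) x),
    pderivPlane_sub (D (hh0.mul (q 1 1)) x) (D (hh1.mul (q 1 0)) x),
    pderivPlane_sub (D (hh1.mul (q 0 0)) x) (D (hh0.mul (q 0 1)) x),
    pderivPlane_mul (D hh0 x) (D (q 1 1) x), pderivPlane_mul (D hh1 x) (D (q 1 0) x),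
    pderivPlane_mul (D hh1 x) (D (q 0 0) x), pderivPlane_mul (D hh0 x) (D (q 0 1) x),
    pderivPlane_comp (D hg _) hwd, pderivPlane_comp (D hg _) hwd, det_fderiv_plane hwd,
    fderiv_apply_eq_pderivPlane]
  -- The second derivatives of w cancel by symmetry: the rows of the cofactor matrix are
  -- divergence-free (Piola's identity).
  have c0 := pderivPlane_comm hw0 0 1 x
  have c1 := pderivPlane_comm hw1 0 1 x
  rw [show (fun z => pderivPlane 1 (fun z => w z 1) z) = pderivPlane 1 (fun z => w z 1) from rfl,
    show (fun z => pderivPlane 1 (fun z => w z 0) z) = pderivPlane 1 (fun z => w z 0) from rfl,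
    c0, c1]
  ring

/-- Integrating the divergence by parts moves the derivative onto χ. The field carries the factor
g(w), which vanishes wherever the gradient of χ does not. -/
theorem integral_degree_variation_eq_zero {w h : Plane → Plane} (hg : ContDiff ℝ ∞ g)
    (hw : ContDiff ℝ ∞ w) (hh : ContDiff ℝ ∞ h) (hχ : ContDiff ℝ ∞ χ) (hχc : HasCompactSupport χ)
    (hz : ∀ x i, pderivPlane i χ x * g (w x) = 0) :
    ∫ x, χ x * (fderiv ℝ g (w x) (h x) * (fderiv ℝ w x).det
      + g (w x) * (pderivPlane 0 (fun z => h z 0) x * pderivPlane 1 (fun z => w z 1) x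
        + pderivPlane 0 (fun z => w z 0) x * pderivPlane 1 (fun z => h z 1) x
        - pderivPlane 1 (fun z => h z 0) x * pderivPlane 0 (fun z => w z 1) x
        - pderivPlane 1 (fun z => w z 0) x * pderivPlane 0 (fun z => h z 1) x)) = 0 := by
  have hgw : ContDiff ℝ ∞ fun z => g (w z) := hg.comp hw
  have q : ∀ j k, ContDiff ℝ ∞ fun z => pderivPlane j (fun z => w z k) z :=
    fun j k => contDiff_pderivPlane (contDiff_coord hw k) j
  have hX : ContDiff ℝ ∞ fun z => g (w z) * (h z 0 * pderivPlane 1 (fun z => w z 1) z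
        - h z 1 * pderivPlane 1 (fun z => w z 0) z) :=
    hgw.mul (((contDiff_coord hh 0).mul (q 1 1)).sub ((contDiff_coord hh 1).mul (q 1 0)))
  have hY : ContDiff ℝ ∞ fun z => g (w z) * (h z 1 * pderivPlane 0 (fun z => w z 0) z
        - h z 0 * pderivPlane 0 (fun z => w z 1) z) :=
    hgw.mul (((contDiff_coord hh 1).mul (q 0 0)).sub ((contDiff_coord hh 0).mul (q 0 1)))
  simp only [← div_degree_field hg hw hh, mul_add]
  have I : ∀ {X : Plane → ℝ}, ContDiff ℝ ∞ X → ∀ i, Integrable fun x => χ x * pderivPlane i X x :=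
    fun hX i => (hχ.continuous.mul (contDiff_pderivPlane hX i).continuous)
      |>.integrable_of_hasCompactSupport hχc.mul_right
  rw [integral_add (I hX 0) (I hY 1),
    integral_mul_pderivPlane (hχ.of_le (by simp)) hχc (hX.of_le (by simp)),
    integral_mul_pderivPlane (hχ.of_le (by simp)) hχc (hY.of_le (by simp))]
  simp only [← mul_assoc, hz, zero_mul, integral_zero, neg_zero, add_zero]

/-- Homotopy invariance of `∫ χ g(w) det Dw` along the segment from `w₀` to `w₁`. -/
theorem integral_degree_homotopy {w₀ w₁ : Plane → Plane} (hg : ContDiff ℝ ∞ g)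
    (hw₀ : ContDiff ℝ ∞ w₀) (hw₁ : ContDiff ℝ ∞ w₁) (hχ : ContDiff ℝ ∞ χ)
    (hχc : HasCompactSupport χ)
    (hz : ∀ t ∈ Icc (0 : ℝ) 1, ∀ x i, pderivPlane i χ x * g (w₀ x + t • (w₁ x - w₀ x)) = 0) :
    ∫ x, χ x * (g (w₀ x) * (fderiv ℝ w₀ x).det) = ∫ x, χ x * (g (w₁ x) * (fderiv ℝ w₁ x).det) := by
  have hh : ContDiff ℝ ∞ fun x => w₁ x - w₀ x := hw₁.sub hw₀
  set h : Plane → Plane := fun x => w₁ x - w₀ x with hdef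
  let w : ℝ → Plane → Plane := fun t x => w₀ x + t • h x
  have hw : ∀ t, ContDiff ℝ ∞ (w t) := fun t => hw₀.add (hh.const_smul t)
  have D : ∀ {f : Plane → ℝ}, ContDiff ℝ ∞ f → ∀ x, DifferentiableAt ℝ f x := fun hf x =>
    (hf.differentiable (by simp)).differentiableAt
  have hpd : ∀ t i j x, pderivPlane i (fun z => w t z j) x
      = pderivPlane i (fun z => w₀ z j) x + t * pderivPlane i (fun z => h z j) x := by
    intro t i j x
    have e : (fun z => w t z j) = fun z => w₀ z j + t * h z j := by ext z; simp [w]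
    rw [e, pderivPlane_add (D (contDiff_coord hw₀ j) x)
      (D (contDiff_const.mul (contDiff_coord hh j)) x),
      pderivPlane_const_mul t (D (contDiff_coord hh j) x)]
  have hdet : ∀ t x, (fderiv ℝ (w t) x).det =
      (pderivPlane 0 (fun z => w₀ z 0) x + t * pderivPlane 0 (fun z => h z 0) x)
        * (pderivPlane 1 (fun z => w₀ z 1) x + t * pderivPlane 1 (fun z => h z 1) x)
      - (pderivPlane 1 (fun z => w₀ z 0) x + t * pderivPlane 1 (fun z => h z 0) x)
        * (pderivPlane 0 (fun z => w₀ z 1) x + t * pderivPlane 0 (fun z => h z 1) x) := by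
    intro t x
    rw [det_fderiv_plane ((hw t).differentiable (by simp)).differentiableAt]
    simp only [hpd]
  let Φ : ℝ → Plane → ℝ := fun t x => χ x * (g (w t x) * (fderiv ℝ (w t) x).det)
  let Φ' : ℝ → Plane → ℝ := fun t x => χ x * (fderiv ℝ g (w t x) (h x) * (fderiv ℝ (w t) x).det
      + g (w t x) * (pderivPlane 0 (fun z => h z 0) x * pderivPlane 1 (fun z => w t z 1) x
        + pderivPlane 0 (fun z => w t z 0) x * pderivPlane 1 (fun z => h z 1) x
        - pderivPlane 1 (fun z => h z 0) x * pderivPlane 0 (fun z => w t z 1) x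
        - pderivPlane 1 (fun z => w t z 0) x * pderivPlane 0 (fun z => h z 1) x))
  have hΦ : ∀ t x, HasDerivAt (fun s => Φ s x) (Φ' t x) t := by
    intro t x
    have hwt : HasDerivAt (fun s => w s x) (h x) t := by
      have := ((hasDerivAt_id t).smul_const (h x)).const_add (w₀ x)
      rw [one_smul] at this
      exact this
    have h1 : HasDerivAt (fun s => g (w s x)) (fderiv ℝ g (w t x) (h x)) t :=
      (D hg (w t x)).hasFDerivAt.comp_hasDerivAt t hwt
    have hl : ∀ a b : ℝ, HasDerivAt (fun s : ℝ => a + s * b) b t := fun a b => by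
      simpa using ((hasDerivAt_id t).mul_const b).const_add a
    have h2 := ((hl (pderivPlane 0 (fun z => w₀ z 0) x) (pderivPlane 0 (fun z => h z 0) x)).mul
      (hl (pderivPlane 1 (fun z => w₀ z 1) x) (pderivPlane 1 (fun z => h z 1) x))).sub
      ((hl (pderivPlane 1 (fun z => w₀ z 0) x) (pderivPlane 1 (fun z => h z 0) x)).mul
      (hl (pderivPlane 0 (fun z => w₀ z 1) x) (pderivPlane 0 (fun z => h z 1) x)))
    have h3 := (h1.mul h2).const_mul (χ x)
    have e : (fun s => Φ s x) = fun s => χ x * (g (w s x) *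
      ((pderivPlane 0 (fun z => w₀ z 0) x + s * pderivPlane 0 (fun z => h z 0) x)
        * (pderivPlane 1 (fun z => w₀ z 1) x + s * pderivPlane 1 (fun z => h z 1) x)
      - (pderivPlane 1 (fun z => w₀ z 0) x + s * pderivPlane 1 (fun z => h z 0) x)
        * (pderivPlane 0 (fun z => w₀ z 1) x + s * pderivPlane 0 (fun z => h z 1) x))) := by
      ext s; simp only [Φ, hdet]
    rw [e]
    convert! h3 using 1
    simp only [Φ', hdet, hpd, Pi.mul_apply, Pi.sub_apply]
    ring
  have cpd : ∀ {u : Plane → Plane}, ContDiff ℝ ∞ u → ∀ i j : Fin 2,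
      Continuous (pderivPlane i fun z => u z j) := fun hu i j =>
    (contDiff_pderivPlane (contDiff_coord hu j) i).continuous
  have hΦ'c : Continuous (uncurry Φ') := by
    have cw : Continuous fun p : ℝ × Plane => w p.1 p.2 :=
      (hw₀.continuous.comp continuous_snd).add
        (continuous_fst.smul (hh.continuous.comp continuous_snd))
    have c1 : Continuous fun p : ℝ × Plane => fderiv ℝ g (w p.1 p.2) (h p.2) :=
      ((hg.continuous_fderiv (by simp)).comp cw).clm_apply (hh.continuous.comp continuous_snd)
    have c2 := hg.continuous.comp cw
    have c3 := hχ.continuous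
    have k0 := fun i j => (cpd hw₀ i j).comp (continuous_snd (X := ℝ))
    have k1 := fun i j => (cpd hh i j).comp (continuous_snd (X := ℝ))
    have k2 : ∀ i j, Continuous fun p : ℝ × Plane => pderivPlane i (fun z => w₀ z j) p.2
        + p.1 * pderivPlane i (fun z => h z j) p.2 := fun i j =>
      (k0 i j).add (continuous_fst.mul (k1 i j))
    simp only [uncurry_def, Φ', hdet, hpd]
    exact (c3.comp continuous_snd).mul ((c1.mul (((k2 0 0).mul (k2 1 1)).sub
      ((k2 1 0).mul (k2 0 1)))).add (c2.mul (((((k1 0 0).mul (k2 1 1)).add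
      ((k2 0 0).mul (k1 1 1))).sub ((k1 1 0).mul (k2 0 1))).sub ((k2 1 0).mul (k1 0 1)))))
  have hint : Integrable (uncurry Φ') ((volume.restrict (uIoc (0 : ℝ) 1)).prod volume) := by
    have hK : IsCompact (Icc (0 : ℝ) 1 ×ˢ tsupport χ) := isCompact_Icc.prod hχc
    have h1 : IntegrableOn (uncurry Φ') (Icc (0 : ℝ) 1 ×ˢ tsupport χ) (volume.prod volume) :=
      hΦ'c.continuousOn.integrableOn_compact hK
    have h2 : IntegrableOn (uncurry Φ') (Icc (0 : ℝ) 1 ×ˢ univ) (volume.prod volume) := by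
      refine h1.of_forall_sdiff_eq_zero (measurableSet_Icc.prod MeasurableSet.univ) fun p hp => ?_
      have : p.2 ∉ tsupport χ := fun h => hp.2 ⟨hp.1.1, h⟩
      change χ p.2 * _ = 0
      rw [image_eq_zero_of_notMem_tsupport this, zero_mul]
    rw [uIoc_of_le zero_le_one]
    have h3 := h2.mono_set (s := Ioc (0 : ℝ) 1 ×ˢ univ) (prod_mono Ioc_subset_Icc_self le_rfl)
    rwa [IntegrableOn, ← Measure.prod_restrict, Measure.restrict_univ] at h3
  have hI : ∀ t, Integrable (Φ t) := fun t => by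
    have : Continuous (Φ t) := by
      simp only [Φ, hdet]
      have k2 : ∀ i j, Continuous fun x => pderivPlane i (fun z => w₀ z j) x
          + t * pderivPlane i (fun z => h z j) x := fun i j =>
        (cpd hw₀ i j).add (continuous_const.mul (cpd hh i j))
      exact hχ.continuous.mul ((hg.continuous.comp (hw t).continuous).mul
        (((k2 0 0).mul (k2 1 1)).sub ((k2 1 0).mul (k2 0 1))))
    exact this.integrable_of_hasCompactSupport hχc.mul_right
  -- Write the difference as an integral of the variation over t and apply Fubini; the space
  -- integral is zero for each t.
  have hsub : ∫ x, (Φ 1 x - Φ 0 x) = 0 := by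
    have e : ∀ x, Φ 1 x - Φ 0 x = ∫ t in (0 : ℝ)..1, Φ' t x := fun x =>
      (intervalIntegral.integral_eq_sub_of_hasDerivAt (fun t _ => hΦ t x)
        ((hΦ'c.comp (by fun_prop : Continuous fun t : ℝ => (t, x))).intervalIntegrable 0 1)).symm
    simp only [e]
    rw [← intervalIntegral_integral_swap hint]
    refine (intervalIntegral.integral_congr (g := fun _ => (0 : ℝ)) fun t ht => ?_).trans (by simp)
    rw [uIcc_of_le zero_le_one] at ht
    exact integral_degree_variation_eq_zero hg (hw t) hh hχ hχc (hz t ht)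
  rw [integral_sub (hI 1) (hI 0), sub_eq_zero] at hsub
  have e0 : w 0 = w₀ := by ext1 x; simp [w]
  have e1 : w 1 = w₁ := by ext1 x; simp [w, h]
  simp only [Φ, e0, e1] at hsub
  exact hsub.symm

end Homotopy

/-! ### The degree of a smooth map at a regular value -/

/-- Near a nondegenerate point a smooth map is injective, open at the point, and its Jacobian
determinant has constant sign. -/
theorem exists_nhds_injOn_sign_det {w : Plane → Plane} (hw : ContDiff ℝ ∞ w) {x : Plane}
    (hx : (fderiv ℝ w x).det ≠ 0) :
    ∃ N : Set Plane, IsOpen N ∧ x ∈ N ∧ InjOn w N ∧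
      ∀ z ∈ N, SignType.sign (fderiv ℝ w z).det = SignType.sign (fderiv ℝ w x).det := by
  have hs : HasStrictFDerivAt w
      ((fderiv ℝ w x).toContinuousLinearEquivOfDetNeZero hx : Plane →L[ℝ] Plane) x := by
    rw [ContinuousLinearMap.coe_toContinuousLinearEquivOfDetNeZero]
    exact hw.contDiffAt.hasStrictFDerivAt (by simp)
  have hc : Continuous fun z => (fderiv ℝ w z).det :=
    ContinuousLinearMap.continuous_det.comp (hw.continuous_fderiv (by simp))
  have hev : ∀ᶠ z in 𝓝 x, SignType.sign (fderiv ℝ w z).det = SignType.sign (fderiv ℝ w x).det := by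
    have h1 : ContinuousAt (fun z => SignType.sign (fderiv ℝ w z).det) x :=
      ContinuousAt.comp (g := SignType.sign) (continuousAt_sign_of_ne_zero hx) hc.continuousAt
    exact h1.eventually_mem ((isOpen_discrete {SignType.sign (fderiv ℝ w x).det}).mem_nhds rfl)
  obtain ⟨O, hO, hOo, hxO⟩ := eventually_nhds_iff.1 hev
  let e := hs.toOpenPartialHomeomorph w
  refine ⟨e.source ∩ O, e.open_source.inter hOo, ⟨hs.mem_toOpenPartialHomeomorph_source, hxO⟩,
    fun a ha b hb hab => e.injOn ha.1 hb.1 hab, fun z hz => hO z hz.2⟩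

theorem image_mem_nhds_of_det_ne_zero {w : Plane → Plane} (hw : ContDiff ℝ ∞ w) {x : Plane}
    (hx : (fderiv ℝ w x).det ≠ 0) {N : Set Plane} (hN : N ∈ 𝓝 x) : w '' N ∈ 𝓝 (w x) := by
  have hs : HasStrictFDerivAt w
      ((fderiv ℝ w x).toContinuousLinearEquivOfDetNeZero hx : Plane →L[ℝ] Plane) x := by
    rw [ContinuousLinearMap.coe_toContinuousLinearEquivOfDetNeZero]
    exact hw.contDiffAt.hasStrictFDerivAt (by simp)
  rw [← hs.map_nhds_eq_of_equiv]
  exact image_mem_map hN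

/-- Change of variables with det = s |det|; the support condition turns the integral over the image
into one over the whole plane. -/
theorem setIntegral_comp_mul_det_of_injOn {w : Plane → Plane} (hw : ContDiff ℝ ∞ w)
    {N : Set Plane} (hN : IsOpen N) (hinj : InjOn w N) {s : SignType}
    (hs : ∀ z ∈ N, SignType.sign (fderiv ℝ w z).det = s) {g : Plane → ℝ}
    (hg : support g ⊆ w '' N) :
    ∫ x in N, g (w x) * (fderiv ℝ w x).det = (s : ℝ) * ∫ z, g z := by
  have h1 := integral_image_eq_integral_abs_det_fderiv_smul volume hN.measurableSet
    (fun x _ => ((hw.differentiable (by simp)).differentiableAt (x := x)).hasFDerivAt.hasFDerivWithinAt)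
    hinj g
  rw [setIntegral_eq_integral_of_forall_compl_eq_zero fun z hz => by
    by_contra h; exact hz (hg h)] at h1
  rw [h1, ← integral_const_mul]
  refine setIntegral_congr_fun hN.measurableSet fun x hx => ?_
  have : (s : ℝ) * |(fderiv ℝ w x).det| = (fderiv ℝ w x).det := by
    rw [← hs x hx]; exact sign_mul_abs _
  change _ = (s : ℝ) * (|(fderiv ℝ w x).det| * g (w x))
  rw [← mul_assoc, this, mul_comm]

/-- The degree at a regular value as an integral. -/
theorem exists_setIntegral_eq_regularDegree_mul {w : Plane → Plane} (hw : ContDiff ℝ ∞ w)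
    {U : Set Plane} (hU : IsOpen U) (hUc : IsCompact (closure U)) {y : Plane}
    (hy : y ∉ w '' frontier U) (hreg : ∀ x ∈ U, w x = y → (fderiv ℝ w x).det ≠ 0) :
    ∃ r > 0, ∀ g : Plane → ℝ, Continuous g → support g ⊆ Metric.ball y r →
      ∫ x in U, g (w x) * (fderiv ℝ w x).det = (regularDegree w U y : ℝ) * ∫ z, g z := by
  set S : Set Plane := {x | x ∈ U ∧ w x = y} with hSdef
  have hSc : IsCompact S := by
    have : S = closure U ∩ w ⁻¹' {y} := by
      ext x
      refine ⟨fun h => ⟨subset_closure h.1, h.2⟩, fun h => ⟨?_, h.2⟩⟩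
      by_contra hxU
      exact hy ⟨x, by rw [hU.frontier_eq]; exact ⟨h.1, hxU⟩, h.2⟩
    rw [this]
    exact hUc.inter_right (isClosed_singleton.preimage hw.continuous)
  choose! N hNo hxN hNinj hNs using fun x (hx : x ∈ S) =>
    exists_nhds_injOn_sign_det hw (hreg x hx.1 hx.2)
  -- By injectivity each member of a finite subcover contains only one preimage of y, its centre.
  have hfin : S.Finite := by
    obtain ⟨t, ht, hSt⟩ := hSc.elim_nhds_subcover N fun x hx => (hNo x hx).mem_nhds (hxN x hx)
    refine t.finite_toSet.subset fun x hx => ?_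
    obtain ⟨z, hz, hxz⟩ := mem_iUnion₂.1 (hSt hx)
    rwa [hNinj z (ht z hz) hxz (hxN z (ht z hz)) (hx.2.trans (ht z hz).2.symm)]
  obtain ⟨V, hV, hVd⟩ := hfin.t2_separation
  let M : Plane → Set Plane := fun x => N x ∩ V x ∩ U
  have hMo : ∀ x ∈ S, IsOpen (M x) := fun x hx => ((hNo x hx).inter (hV x).2).inter hU
  have hxM : ∀ x ∈ S, x ∈ M x := fun x hx => ⟨⟨hxN x hx, (hV x).1⟩, hx.1⟩
  have hMd : S.PairwiseDisjoint M := fun a ha b hb hab =>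
    (hVd ha hb hab).mono (fun z hz => hz.1.2) fun z hz => hz.1.2
  have hMopen : IsOpen (⋃ x ∈ S, M x) := isOpen_biUnion hMo
  have hR : IsCompact (w '' (closure U \ ⋃ x ∈ S, M x)) :=
    (hUc.diff hMopen).image hw.continuous
  -- Away from the chosen neighbourhoods w stays at positive distance from y, so for g concentrated
  -- near y only these neighbourhoods contribute.
  have hyR : (w '' (closure U \ ⋃ x ∈ S, M x))ᶜ ∈ 𝓝 y := by
    refine hR.isClosed.isOpen_compl.mem_nhds ?_
    rintro ⟨x, ⟨hx, hxM'⟩, hxy⟩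
    by_cases hxU : x ∈ U
    · exact hxM' (mem_iUnion₂.2 ⟨x, ⟨hxU, hxy⟩, hxM x ⟨hxU, hxy⟩⟩)
    · exact hy ⟨x, by rw [hU.frontier_eq]; exact ⟨hx, hxU⟩, hxy⟩
  have hyM : ⋂ x ∈ S, w '' M x ∈ 𝓝 y := by
    rw [biInter_mem hfin]
    intro x hx
    rw [← hx.2]
    exact image_mem_nhds_of_det_ne_zero hw (hreg x hx.1 hx.2) ((hMo x hx).mem_nhds (hxM x hx))
  obtain ⟨r, hr, hball⟩ := Metric.mem_nhds_iff.1 (inter_mem hyR hyM)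
  refine ⟨r, hr, fun g hg hgs => ?_⟩
  have hcont : Continuous fun x => g (w x) * (fderiv ℝ w x).det :=
    (hg.comp hw.continuous).mul
      (ContinuousLinearMap.continuous_det.comp (hw.continuous_fderiv (by simp)))
  have hint : ∀ {A : Set Plane}, A ⊆ U → IntegrableOn (fun x => g (w x) * (fderiv ℝ w x).det) A :=
    fun hA => (hcont.continuousOn.integrableOn_compact hUc).mono_set (hA.trans subset_closure)
  have e1 : ∫ x in U, g (w x) * (fderiv ℝ w x).det
      = ∫ x in ⋃ x ∈ hfin.toFinset, M x, g (w x) * (fderiv ℝ w x).det := by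
    refine setIntegral_eq_of_subset_of_forall_sdiff_eq_zero hU.measurableSet ?_ ?_
    · exact iUnion₂_subset fun x _ z hz => hz.2
    · intro x hx
      have : g (w x) = 0 := by
        by_contra h
        refine (hball (hgs h)).1 ⟨x, ⟨subset_closure hx.1, fun hx' => hx.2 ?_⟩, rfl⟩
        simpa using hx'
      rw [this, zero_mul]
  rw [e1, integral_biUnion_finset hfin.toFinset
    (fun x hx => (hMo x (hfin.mem_toFinset.1 hx)).measurableSet) (by rwa [hfin.coe_toFinset])
    fun x _ => hint fun z hz => hz.2]
  have e2 : ∀ x ∈ hfin.toFinset, ∫ z in M x, g (w z) * (fderiv ℝ w z).det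
      = ((SignType.sign (fderiv ℝ w x).det : SignType) : ℝ) * ∫ z, g z := by
    intro x hx
    have hxS := hfin.mem_toFinset.1 hx
    refine setIntegral_comp_mul_det_of_injOn hw (hMo x hxS)
      ((hNinj x hxS).mono fun z hz => hz.1.1) (fun z hz => hNs x hxS z hz.1.1) fun z hz => ?_
    exact mem_iInter₂.1 (hball (hgs hz)).2 x hxS
  rw [Finset.sum_congr rfl e2, ← Finset.sum_mul]
  congr 1
  rw [regularDegree, finsum_mem_eq_finite_toFinset_sum _ hfin]
  push_cast
  refine Finset.sum_congr rfl fun x _ => ?_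
  cases SignType.sign (fderiv ℝ w x).det <;> simp

/-! ### Existence of admissible approximations -/

/-- By Sard's theorem some z within d/2 of y is a regular value of an approximation w. Translating w
by y - z makes y regular at a cost below d/2, and the other half of d pays for the approximation. -/
theorem exists_isDegreeApprox {u : Plane → Plane} {U : Set Plane} {y : Plane}
    (happ : ∀ η > 0, ∃ w : Plane → Plane, ContDiff ℝ ∞ w ∧ ∀ x ∈ closure U, dist (w x) (u x) < η)
    (hd : 0 < Metric.infDist y (u '' frontier U)) : ∃ w, IsDegreeApprox u U y w := by
  set d := Metric.infDist y (u '' frontier U)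
  obtain ⟨w, hw, hwu⟩ := happ (d / 2) (by positivity)
  have hcrit : volume (w '' {x | (fderiv ℝ w x).det = 0}) = 0 :=
    addHaar_image_eq_zero_of_det_fderivWithin_eq_zero volume
      (fun x _ => ((hw.differentiable (by simp)).differentiableAt (x := x)).hasFDerivAt.hasFDerivWithinAt)
      fun x hx => hx
  obtain ⟨z, hz, hzc⟩ : ∃ z ∈ Metric.ball y (d / 2), z ∉ w '' {x | (fderiv ℝ w x).det = 0} := by
    by_contra! h
    have := measure_mono_null (fun z hz => h z hz) hcrit
    exact (Metric.measure_ball_pos volume y (by positivity : 0 < d / 2)).ne' this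
  have hfd : ∀ x, fderiv ℝ (fun x => w x + (y - z)) x = fderiv ℝ w x := fun x =>
    fderiv_add_const _
  refine ⟨fun x => w x + (y - z), hw.add contDiff_const, fun x hx => ?_, fun x _ hxy hdet => ?_⟩
  · calc dist (w x + (y - z)) (u x) ≤ dist (w x + (y - z)) (w x) + dist (w x) (u x) :=
        dist_triangle _ _ _
      _ < d / 2 + d / 2 := by
        refine add_lt_add ?_ (hwu x hx)
        rw [dist_eq_norm, add_sub_cancel_left, ← dist_eq_norm, dist_comm]
        exact hz
      _ = d := by ring
  · rw [hfd] at hdet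
    refine hzc ⟨x, hdet, ?_⟩
    have : w x + (y - z) = y := hxy
    rw [← sub_eq_zero] at this ⊢
    rw [← this]
    abel

/-- Local integral representation of the Brouwer degree: near `y` the degree can be computed by
integrating over the graph of any smooth map that is sufficiently close to `u`. -/
theorem exists_brouwerDegree_mul_integral_eq {u : Plane → Plane} {U : Set Plane} {y : Plane}
    (hU : IsOpen U) (hUc : IsCompact (closure U)) (hne : U.Nonempty)
    (hu : ContinuousOn u (closure U)) (hy : y ∉ u '' frontier U)
    (happ : ∀ η > 0, ∃ w : Plane → Plane, ContDiff ℝ ∞ w ∧ ∀ x ∈ closure U, dist (w x) (u x) < η) :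
    ∃ η > 0, ∃ χ : Plane → ℝ, ContDiff ℝ ∞ χ ∧ HasCompactSupport χ ∧ tsupport χ ⊆ U ∧
      (∀ x ∈ closure U, dist (u x) y < 2 * η → χ x = 1) ∧
      ∀ W : Plane → Plane, ContDiff ℝ ∞ W → (∀ x ∈ closure U, dist (W x) (u x) < η) →
      ∀ g : Plane → ℝ, ContDiff ℝ ∞ g → support g ⊆ Metric.ball y η →
        (brouwerDegree u U y : ℝ) * ∫ z, g z = ∫ x, χ x * (g (W x) * (fderiv ℝ W x).det) := by
  have hfc : IsCompact (frontier U) := hUc.of_isClosed_subset isClosed_frontier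
    frontier_subset_closure
  have hfi : IsCompact (u '' frontier U) := hfc.image_of_continuousOn
    (hu.mono frontier_subset_closure)
  -- `Metric.infDist` to the empty set is 0, so the boundary must be nonempty. Otherwise U would be
  -- clopen in the connected plane, hence empty or noncompact.
  have hfne : (frontier U).Nonempty := by
    rw [nonempty_iff_ne_empty]
    intro h
    have hcl : IsClopen U := ⟨by
      rw [← closure_subset_iff_isClosed]
      intro x hx
      by_contra hxU
      have : x ∈ frontier U := by rw [hU.frontier_eq]; exact ⟨hx, hxU⟩
      rw [h] at this
      exact this, hU⟩
    rcases isClopen_iff.1 hcl with h | h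
    · exact hne.ne_empty h
    · rw [h, closure_univ] at hUc
      exact NoncompactSpace.noncompact_univ hUc
  have hd : 0 < Metric.infDist y (u '' frontier U) :=
    (hfi.isClosed.notMem_iff_infDist_pos (hfne.image u)).1 hy
  have hex := exists_isDegreeApprox happ hd
  have hdeg : brouwerDegree u U y = regularDegree hex.choose U y := by
    rw [brouwerDegree, dif_pos hex]
  rw [hdeg]
  obtain ⟨hw, hwu, hreg⟩ := hex.choose_spec
  -- Only the defining properties of the selected approximation are used, so the arbitrary choice in
  -- the definition of the degree is harmless.
  generalize hex.choose = w at hw hwu hreg ⊢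
  set d := Metric.infDist y (u '' frontier U)
  have hfd : ∀ x ∈ frontier U, d ≤ dist (u x) y := fun x hx => by
    rw [dist_comm]; exact Metric.infDist_le_dist_of_mem ⟨x, hx, rfl⟩
  have hyw : y ∉ w '' frontier U := by
    rintro ⟨x, hx, rfl⟩
    have h1 := hwu x (frontier_subset_closure hx)
    have h2 := hfd x hx
    rw [dist_comm] at h2
    linarith
  obtain ⟨r, hr, hA⟩ := exists_setIntegral_eq_regularDegree_mul hw hU hUc hyw hreg
  obtain ⟨x₀, hx₀, hmax⟩ := hUc.exists_isMaxOn (hne.mono subset_closure)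
    (f := fun x => dist (w x) (u x)) (continuous_dist.comp_continuousOn (hw.continuous.continuousOn.prodMk hu))
  have hm0 := dist_nonneg (x := w x₀) (y := u x₀)
  have hmd : dist (w x₀) (u x₀) < d := hwu x₀ hx₀
  set m := dist (w x₀) (u x₀) with hm
  -- The bound m + 3η ≤ d has three uses for η: the segment from w to W stays within m + η of u, the
  -- support of g costs another η, and the last η keeps the relevant points in a compact subset S of
  -- U. As m ≥ 0, also 2η ≤ d - η.
  set η := min r ((d - m) / 3) with hη
  have hη0 : 0 < η := lt_min hr (by linarith)
  have hηr : η ≤ r := min_le_left _ _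
  have hηd : m + 3 * η ≤ d := by
    have : η ≤ (d - m) / 3 := min_le_right _ _
    linarith
  let S : Set Plane := {x ∈ closure U | dist (u x) y ≤ d - η}
  have hSc : IsCompact S := by
    have h1 : ContinuousOn (fun x => dist (u x) y) (closure U) := 
      continuous_dist.comp_continuousOn (hu.prodMk continuousOn_const)
    have := h1.preimage_isClosed_of_isClosed isClosed_closure (isClosed_Iic (a := d - η))
    exact hUc.of_isClosed_subset this inter_subset_left
  have hSU : S ⊆ U := by
    intro x hx
    by_contra hxU
    have := hfd x (by rw [hU.frontier_eq]; exact ⟨hx.1, hxU⟩)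
    linarith [hx.2]
  obtain ⟨χ, hχ, hχc, hχs, -, hχ1⟩ := exists_smooth_cutoff hSc hU hSU
  refine ⟨η, hη0, χ, hχ, hχc, hχs, fun x hx hxy => hχ1.self_of_nhdsSet x ⟨hx, by linarith⟩,
    fun W hW hWu g hg hgs => ?_⟩
  have hseg : ∀ t ∈ Icc (0 : ℝ) 1, ∀ x ∈ closure U,
      g (w x + t • (W x - w x)) ≠ 0 → x ∈ S := by
    intro t ht x hx hgx
    have h1 : dist (w x + t • (W x - w x)) y < η := hgs hgx
    have h2 : dist (w x + t • (W x - w x)) (u x) ≤ max (dist (w x) (u x)) (dist (W x) (u x)) :=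
      (convexOn_univ_dist (u x)).le_max_of_mem_segment (mem_univ _) (mem_univ _)
        ((segment_eq_image' ℝ (w x) (W x)).symm ▸ ⟨t, ht, rfl⟩)
    have h3 : dist (w x) (u x) ≤ m := hmax hx
    have h4 := hWu x hx
    have h5 : max (dist (w x) (u x)) (dist (W x) (u x)) ≤ m + η :=
      max_le (by linarith) (by linarith)
    have h6 := dist_triangle_left (u x) y (w x + t • (W x - w x))
    exact ⟨hx, by linarith⟩
  have hχ0 : ∀ x, x ∉ U → χ x = 0 := fun x hx =>
    image_eq_zero_of_notMem_tsupport fun h => hx (hχs h)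
  rw [← integral_degree_homotopy hg hw hW hχ hχc, ← hA g hg.continuous
    (hgs.trans (Metric.ball_subset_ball hηr)), ← integral_indicator hU.measurableSet]
  · refine integral_congr_ae (ae_of_all _ fun x => ?_)
    by_cases hx : x ∈ U
    · rw [indicator_of_mem hx]
      by_cases hgx : g (w x) = 0
      · simp [hgx]
      · have := hseg 0 (by simp) x (subset_closure hx) (by simpa using hgx)
        simp only [hχ1.self_of_nhdsSet x this, one_mul]
    · rw [indicator_of_notMem hx]
      simp only [hχ0 x hx, zero_mul]
  · intro t ht x i
    by_cases hxχ : x ∈ tsupport χ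
    · by_cases hgx : g (w x + t • (W x - w x)) = 0
      · rw [hgx, mul_zero]
      · have hS := hseg t ht x (subset_closure (hχs hxχ)) hgx
        have h1 : χ =ᶠ[𝓝 x] fun _ => 1 := eventually_nhdsSet_iff_forall.1 hχ1 x hS
        rw [pderivPlane, h1.fderiv_eq]
        simp
    · rw [image_eq_zero_of_notMem_tsupport fun h => hxχ (tsupport_pderivPlane_subset _ _ h),
        zero_mul]

/-! ### Localisation of the potential -/

/-- `V` is a compactly supported `C¹` function whose gradient agrees on the compact set `K` with
that of `v` and is `α`-Hölder there, and `K` contains the closed `ε`-neighbourhood of `U`. -/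
structure IsLocalPotential (v V : Plane → ℝ) (U K : Set Plane) (ε H α : ℝ) : Prop where
  contDiff : ContDiff ℝ 1 V
  hasCompactSupport : HasCompactSupport V
  isCompact : IsCompact K
  closedBall_subset : ∀ x ∈ closure U, Metric.closedBall x ε ⊆ K
  pderivPlane_eq : ∀ x ∈ K, ∀ i, pderivPlane i V x = gradient v x i
  holder : ∀ x ∈ K, ∀ z ∈ K, ∀ i, |pderivPlane i V z - pderivPlane i V x| ≤ H * dist z x ^ α

theorem IsC1Holder.continuousOn_gradient {α : ℝ≥0} {v : Plane → ℝ} {Ω : Opens Plane}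
    (hv : IsC1Holder α v Ω) : ContinuousOn (gradient v) Ω :=
  (InnerProductSpace.toDual ℝ Plane).symm.continuous.comp_continuousOn
    (hv.1.continuousOn_fderiv_of_isOpen Ω.isOpen le_rfl)

/-- Values of v outside Ω are arbitrary, so it is multiplied by a cutoff equal to 1 near a closed
thickening of U. The result can be mollified on the whole plane. -/
theorem IsC1Holder.exists_isLocalPotential {α : ℝ≥0} {v : Plane → ℝ} {Ω : Opens Plane}
    (hv : IsC1Holder α v Ω) {U : Set Plane} (hU : CompactlyContained U Ω) :
    ∃ (V : Plane → ℝ) (K : Set Plane) (ε H : ℝ), 0 < ε ∧ 0 ≤ H ∧ K ⊆ Ω ∧ IsLocalPotential v V U K ε H α := by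
  obtain ⟨ε, hε, hK⟩ := hU.1.exists_cthickening_subset_open Ω.isOpen hU.2
  set K := Metric.cthickening ε (closure U)
  have hKc : IsCompact K := hU.1.cthickening
  obtain ⟨χ, hχ, hχc, hχs, -, hχ1⟩ := exists_smooth_cutoff hKc Ω.isOpen hK
  obtain ⟨H, hH⟩ := hv.2 K hKc hK
  have hpd : ∀ x ∈ K, ∀ i, pderivPlane i (fun z => χ z * v z) x = gradient v x i := by
    intro x hx i
    have h1 : (fun z => χ z * v z) =ᶠ[𝓝 x] v := by
      filter_upwards [eventually_nhdsSet_iff_forall.1 hχ1 x hx] with z hz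
      rw [hz, one_mul]
    rw [gradient_apply_eq_pderivPlane, pderivPlane, h1.fderiv_eq]
    rfl
  refine ⟨fun z => χ z * v z, K, ε, H, hε, H.2, hK, ?_, hχc.mul_right, hKc,
    fun x hx => Metric.closedBall_subset_cthickening hx ε, hpd, ?_⟩
  · rw [contDiff_iff_contDiffAt]
    intro x
    by_cases hx : x ∈ tsupport χ
    · exact (hχ.of_le (by simp)).contDiffAt.mul (hv.1.contDiffAt (Ω.isOpen.mem_nhds (hχs hx)))
    · have : (fun z => χ z * v z) =ᶠ[𝓝 x] fun _ => 0 := by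
        filter_upwards [(isClosed_tsupport χ).isOpen_compl.mem_nhds hx] with z hz
        rw [image_eq_zero_of_notMem_tsupport hz, zero_mul]
      exact contDiffAt_const.congr_of_eventuallyEq this
  · intro x hx z hz i
    rw [hpd x hx, hpd z hz]
    calc |gradient v z i - gradient v x i| = ‖(gradient v z - gradient v x) i‖ := rfl
      _ ≤ ‖gradient v z - gradient v x‖ := PiLp.norm_apply_le _ i
      _ = dist (gradient v z) (gradient v x) := (dist_eq_norm _ _).symm
      _ ≤ H * dist z x ^ (α : ℝ) := hH.dist_le hz hx

/-! ### The very weak Hessian determinant and mollification -/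

section Defect

variable {ψ : Plane → ℝ}

/-- The weak form of `-½ (∂₁₁ A + ∂₀₀ B - ∂₁∂₀ M - ∂₀∂₁ M)`, with one derivative on each factor. -/
noncomputable def hessianForm (ψ A B M : Plane → ℝ) : ℝ :=
  1 / 2 * ((∫ x, pderivPlane 1 A x * pderivPlane 1 ψ x) + (∫ x, pderivPlane 0 B x * pderivPlane 0 ψ x)
    - (∫ x, pderivPlane 1 M x * pderivPlane 0 ψ x) - ∫ x, pderivPlane 0 M x * pderivPlane 1 ψ x)

theorem integrable_pderivPlane_mul (hψ : ContDiff ℝ ∞ ψ) (hψc : HasCompactSupport ψ)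
    {A : Plane → ℝ} (hA : ContDiff ℝ ∞ A) (i j : Fin 2) :
    Integrable fun x => pderivPlane i A x * pderivPlane j ψ x :=
  ((contDiff_pderivPlane hA i).continuous.mul
    (contDiff_pderivPlane hψ j).continuous).integrable_of_hasCompactSupport
    (hψc.pderivPlane j).mul_left

/-- For a smooth gradient field `(a, b)` the form `hessianForm` computes the integral against the
Hessian determinant. -/
theorem hessianForm_gradient_eq (hψ : ContDiff ℝ ∞ ψ) (hψc : HasCompactSupport ψ)
    {a b : Plane → ℝ} (ha : ContDiff ℝ ∞ a) (hb : ContDiff ℝ ∞ b)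
    (hab : ∀ x, pderivPlane 1 a x = pderivPlane 0 b x) :
    hessianForm ψ (fun x => a x * a x) (fun x => b x * b x) (fun x => a x * b x)
      = ∫ x, ψ x * (pderivPlane 0 a x * pderivPlane 1 b x
        - pderivPlane 1 a x * pderivPlane 0 b x) := by
  have D : ∀ {f : Plane → ℝ}, ContDiff ℝ ∞ f → ∀ x, DifferentiableAt ℝ f x := fun hf x =>
    (hf.differentiable (by simp)).differentiableAt
  have q : ∀ {f : Plane → ℝ}, ContDiff ℝ ∞ f → ∀ i, ContDiff ℝ ∞ (pderivPlane i f) :=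
    contDiff_pderivPlane
  have I : ∀ {A : Plane → ℝ}, ContDiff ℝ ∞ A → ∀ i j,
      Integrable fun x => pderivPlane i A x * pderivPlane j ψ x :=
    fun hA => integrable_pderivPlane_mul hψ hψc hA
  have e1 : ∀ x, pderivPlane 1 (fun x => a x * a x) x - pderivPlane 0 (fun x => a x * b x) x
      = a x * pderivPlane 1 a x - b x * pderivPlane 0 a x := by
    intro x
    rw [pderivPlane_mul (D ha x) (D ha x), pderivPlane_mul (D ha x) (D hb x), ← hab]
    ring
  have e2 : ∀ x, pderivPlane 0 (fun x => b x * b x) x - pderivPlane 1 (fun x => a x * b x) x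
      = b x * pderivPlane 1 a x - a x * pderivPlane 1 b x := by
    intro x
    rw [pderivPlane_mul (D hb x) (D hb x), pderivPlane_mul (D ha x) (D hb x), ← hab]
    ring
  -- Each pure term is paired with a mixed one. In ∂₁X + ∂₀Y all second derivatives cancel by the
  -- symmetry `hab`, leaving -2 times the determinant.
  let X : Plane → ℝ := fun x => a x * pderivPlane 1 a x - b x * pderivPlane 0 a x
  let Y : Plane → ℝ := fun x => b x * pderivPlane 1 a x - a x * pderivPlane 1 b x
  have hX : ContDiff ℝ ∞ X := (ha.mul (q ha 1)).sub (hb.mul (q ha 0))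
  have hY : ContDiff ℝ ∞ Y := (hb.mul (q ha 1)).sub (ha.mul (q hb 1))
  have s1 : (∫ x, pderivPlane 1 (fun x => a x * a x) x * pderivPlane 1 ψ x)
      - ∫ x, pderivPlane 0 (fun x => a x * b x) x * pderivPlane 1 ψ x
      = -∫ x, ψ x * pderivPlane 1 X x := by
    rw [integral_mul_pderivPlane (hψ.of_le (by simp)) hψc (hX.of_le (by simp)), neg_neg,
      ← integral_sub (I (ha.mul ha) 1 1) (I (ha.mul hb) 0 1)]
    refine integral_congr_ae (ae_of_all _ fun x => ?_)
    change _ = pderivPlane 1 ψ x * (a x * pderivPlane 1 a x - b x * pderivPlane 0 a x)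
    rw [← e1]
    ring
  have s2 : (∫ x, pderivPlane 0 (fun x => b x * b x) x * pderivPlane 0 ψ x)
      - ∫ x, pderivPlane 1 (fun x => a x * b x) x * pderivPlane 0 ψ x
      = -∫ x, ψ x * pderivPlane 0 Y x := by
    rw [integral_mul_pderivPlane (hψ.of_le (by simp)) hψc (hY.of_le (by simp)), neg_neg,
      ← integral_sub (I (hb.mul hb) 0 0) (I (ha.mul hb) 1 0)]
    refine integral_congr_ae (ae_of_all _ fun x => ?_)
    change _ = pderivPlane 0 ψ x * (b x * pderivPlane 1 a x - a x * pderivPlane 1 b x)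
    rw [← e2]
    ring
  have J : ∀ {Z : Plane → ℝ}, ContDiff ℝ ∞ Z → ∀ i, Integrable fun x => ψ x * pderivPlane i Z x :=
    fun hZ i => (hψ.continuous.mul (q hZ i).continuous).integrable_of_hasCompactSupport
      hψc.mul_right
  have hdiv : ∀ x, pderivPlane 1 X x + pderivPlane 0 Y x
      = -2 * (pderivPlane 0 a x * pderivPlane 1 b x - pderivPlane 1 a x * pderivPlane 0 b x) := by
    intro x
    rw [pderivPlane_sub (D (ha.mul (q ha 1)) x) (D (hb.mul (q ha 0)) x),
      pderivPlane_sub (D (hb.mul (q ha 1)) x) (D (ha.mul (q hb 1)) x),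
      pderivPlane_mul (D ha x) (D (q ha 1) x), pderivPlane_mul (D hb x) (D (q ha 0) x),
      pderivPlane_mul (D hb x) (D (q ha 1) x), pderivPlane_mul (D ha x) (D (q hb 1) x),
      pderivPlane_comm ha 0 1 x, pderivPlane_comm hb 0 1 x,
      ← (funext hab : pderivPlane 1 a = pderivPlane 0 b)]
    ring
  have s3 : (∫ x, ψ x * pderivPlane 1 X x) + ∫ x, ψ x * pderivPlane 0 Y x
      = -2 * ∫ x, ψ x * (pderivPlane 0 a x * pderivPlane 1 b x
        - pderivPlane 1 a x * pderivPlane 0 b x) := by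
    rw [← integral_add (J hX 1) (J hY 0), ← integral_const_mul]
    refine integral_congr_ae (ae_of_all _ fun x => ?_)
    change ψ x * pderivPlane 1 X x + ψ x * pderivPlane 0 Y x = _
    rw [← mul_add, hdiv]
    ring
  rw [hessianForm]
  linarith

/-- Self-adjointness of mollification and a single integration by parts. Only one derivative remains
on ψ, so the error will involve no second derivatives of the test function. -/
theorem integral_mul_pderivPlane_pderivPlane_mollify {ρ h : Plane → ℝ} {ε C : ℝ}
    (hρ : IsMollifier ρ ε C) (hh : Continuous h) (hhc : HasCompactSupport h)
    (hψ : ContDiff ℝ ∞ ψ) (hψc : HasCompactSupport ψ) (i j : Fin 2) :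
    ∫ x, h x * pderivPlane i (pderivPlane j (mollify ρ ψ)) x
      = -∫ x, pderivPlane i (mollify ρ h) x * pderivPlane j ψ x := by
  have q := contDiff_pderivPlane hψ j
  have e1 : pderivPlane j (mollify ρ ψ) = mollify ρ (pderivPlane j ψ) := funext fun x =>
    pderivPlane_mollify_right hρ.continuous (hψ.of_le (by simp)) hψc j x
  have e2 : pderivPlane i (mollify ρ (pderivPlane j ψ))
      = mollify ρ (pderivPlane i (pderivPlane j ψ)) := funext fun x =>
    pderivPlane_mollify_right hρ.continuous (q.of_le (by simp)) (hψc.pderivPlane j) i x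
  rw [e1, e2, ← integral_mollify_mul hρ.continuous hρ.even hh hhc
    (contDiff_pderivPlane q i).continuous ((hψc.pderivPlane j).pderivPlane i)]
  have := integral_mul_pderivPlane (q.of_le (by simp)) (hψc.pderivPlane j)
    ((contDiff_mollify hρ.contDiff hρ.hasCompactSupport hh).of_le (by simp)) i
  simp only [mul_comm (mollify ρ h _), mul_comm (pderivPlane i (mollify ρ h) _)]
  rw [this, neg_neg]

variable {v V : Plane → ℝ} {U K : Set Plane} {ε₀ H α : ℝ} {ρ : Plane → ℝ} {ε C : ℝ}

theorem tsupport_mollify_subset (hρ : IsMollifier ρ ε C) (hK : IsClosed K)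
    (hUK : ∀ x ∈ closure U, Metric.closedBall x ε ⊆ K) (hψU : tsupport ψ ⊆ U) :
    tsupport (mollify ρ ψ) ⊆ K := by
  refine closure_minimal (fun x hx => ?_) hK
  by_contra hxK
  refine hx (integral_eq_zero_of_ae (ae_of_all _ fun t => ?_))
  change ρ t * ψ (x - t) = 0
  by_cases ht : t ∈ Metric.ball (0 : Plane) ε
  · have : x - t ∉ tsupport ψ := fun h => hxK <| hUK _ (subset_closure (hψU h)) <| by
      rw [Metric.mem_closedBall, dist_eq_norm, sub_sub_cancel]
      exact (mem_ball_zero_iff.1 ht).le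
    rw [image_eq_zero_of_notMem_tsupport this, mul_zero]
  · rw [notMem_support.1 fun h => ht (hρ.support_subset h), zero_mul]

/-- The mollified test function, as a test function on `Ω`. -/
noncomputable def mollifiedTestFunction {Ω : Opens Plane} (hρ : IsMollifier ρ ε C)
    (hK : IsClosed K) (hKΩ : K ⊆ Ω) (hUK : ∀ x ∈ closure U, Metric.closedBall x ε ⊆ K)
    (hψ : ContDiff ℝ ∞ ψ) (hψc : HasCompactSupport ψ) (hψU : tsupport ψ ⊆ U) : 𝓓(Ω, ℝ) :=
  ⟨mollify ρ ψ, contDiff_mollify hρ.contDiff hρ.hasCompactSupport hψ.continuous,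
    hasCompactSupport_mollify hρ.hasCompactSupport hψc,
    (tsupport_mollify_subset hρ hK hUK hψU).trans hKΩ⟩

/-- The distribution tested with ρ * ψ sees mollified products, whereas the smooth Hessian
determinant sees products of mollifications. The same bilinear form now expresses both. -/
theorem veryWeakHessianDet_mollify {Ω : Opens Plane} (hv : ContinuousOn (gradient v) Ω)
    (hV : IsLocalPotential v V U K ε₀ H α) (hKΩ : K ⊆ Ω) (hρ : IsMollifier ρ ε C)
    (hUK : ∀ x ∈ closure U, Metric.closedBall x ε ⊆ K)
    (hψ : ContDiff ℝ ∞ ψ) (hψc : HasCompactSupport ψ) (hψU : tsupport ψ ⊆ U) :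
    veryWeakHessianDet Ω v
        (mollifiedTestFunction hρ hV.isCompact.isClosed hKΩ hUK hψ hψc hψU)
      = hessianForm ψ (mollify ρ fun x => pderivPlane 0 V x * pderivPlane 0 V x)
        (mollify ρ fun x => pderivPlane 1 V x * pderivPlane 1 V x)
        (mollify ρ fun x => pderivPlane 0 V x * pderivPlane 1 V x) := by
  have hs := tsupport_mollify_subset hρ hV.isCompact.isClosed hUK hψU
  have hc : ∀ i, Continuous (pderivPlane i V) := continuous_pderivPlane hV.contDiff
  have hcc : ∀ i, HasCompactSupport (pderivPlane i V) := hV.hasCompactSupport.pderivPlane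
  rw [veryWeakHessianDet_apply hv (a := pderivPlane 0 V) (b := pderivPlane 1 V) _
    (fun x hx => hV.pderivPlane_eq x (hs hx) 0) (fun x hx => hV.pderivPlane_eq x (hs hx) 1)]
  have key : ∀ i j k l, ∫ x, pderivPlane i V x * pderivPlane j V x
      * pderivPlane k (pderivPlane l (mollify ρ ψ)) x
      = -∫ x, pderivPlane k (mollify ρ fun x => pderivPlane i V x * pderivPlane j V x) x
        * pderivPlane l ψ x := fun i j k l =>
    integral_mul_pderivPlane_pderivPlane_mollify hρ ((hc i).mul (hc j)) (hcc i).mul_right hψ hψc k l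
  change -(1 / 2) * ((∫ x, pderivPlane 0 V x * pderivPlane 0 V x
      * pderivPlane 1 (pderivPlane 1 (mollify ρ ψ)) x)
    + (∫ x, pderivPlane 1 V x * pderivPlane 1 V x
      * pderivPlane 0 (pderivPlane 0 (mollify ρ ψ)) x)
    - (∫ x, pderivPlane 0 V x * pderivPlane 1 V x
      * pderivPlane 1 (pderivPlane 0 (mollify ρ ψ)) x)
    - ∫ x, pderivPlane 0 V x * pderivPlane 1 V x
      * pderivPlane 0 (pderivPlane 1 (mollify ρ ψ)) x) = _
  rw [key, key, key, key, hessianForm]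
  ring

theorem abs_integral_pderivPlane_mul_sub_le (hψ : ContDiff ℝ ∞ ψ) (hψc : HasCompactSupport ψ)
    (hψU : tsupport ψ ⊆ U) (hU : IsCompact (closure U)) {A B : Plane → ℝ} (hA : ContDiff ℝ ∞ A)
    (hB : ContDiff ℝ ∞ B) {i j : Fin 2} {D L : ℝ}
    (hAB : ∀ x ∈ U, |pderivPlane i A x - pderivPlane i B x| ≤ D)
    (hL : ∀ x ∈ U, |pderivPlane j ψ x| ≤ L) (hL0 : 0 ≤ L) (hD0 : 0 ≤ D) :
    |(∫ x, pderivPlane i A x * pderivPlane j ψ x) - ∫ x, pderivPlane i B x * pderivPlane j ψ x|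
      ≤ D * L * volume.real (closure U) := by
  rw [← integral_sub (integrable_pderivPlane_mul hψ hψc hA i j)
    (integrable_pderivPlane_mul hψ hψc hB i j),
    ← setIntegral_eq_integral_of_forall_compl_eq_zero (s := closure U)]
  · rw [← Real.norm_eq_abs]
    refine norm_setIntegral_le_of_norm_le_const hU.measure_lt_top fun x hx => ?_
    rw [← sub_mul, norm_mul]
    by_cases hxψ : x ∈ tsupport ψ
    · exact mul_le_mul (hAB x (hψU hxψ)) (hL x (hψU hxψ)) (abs_nonneg _) hD0
    · rw [image_eq_zero_of_notMem_tsupport fun h => hxψ (tsupport_pderivPlane_subset _ _ h)]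
      simpa using mul_nonneg hD0 hL0
  · intro x hx
    rw [image_eq_zero_of_notMem_tsupport fun h =>
      hx (subset_closure (hψU (tsupport_pderivPlane_subset _ _ h)))]
    ring

/-- The defect between the Hessian determinant of the mollified potential and the mollification of
the very weak Hessian determinant. -/
theorem abs_integral_hessian_sub_veryWeakHessianDet_le {Ω : Opens Plane}
    (hv : ContinuousOn (gradient v) Ω) (hV : IsLocalPotential v V U K ε₀ H α) (hH : 0 ≤ H)
    (hα : 0 ≤ α)
    (hKΩ : K ⊆ Ω) (hρ : IsMollifier ρ ε C) (hε : 0 < ε) (hC : 0 ≤ C)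
    (hU : IsCompact (closure U))
    (hUK : ∀ x ∈ closure U, Metric.closedBall x ε ⊆ K)
    (hψ : ContDiff ℝ ∞ ψ) (hψc : HasCompactSupport ψ) (hψU : tsupport ψ ⊆ U) {L : ℝ} (hL0 : 0 ≤ L)
    (hL : ∀ x ∈ U, ∀ j, |pderivPlane j ψ x| ≤ L) :
    |(∫ x, ψ x * (pderivPlane 0 (mollify ρ (pderivPlane 0 V)) x
          * pderivPlane 1 (mollify ρ (pderivPlane 1 V)) x
        - pderivPlane 1 (mollify ρ (pderivPlane 0 V)) x
          * pderivPlane 0 (mollify ρ (pderivPlane 1 V)) x))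
      - veryWeakHessianDet Ω v
        (mollifiedTestFunction hρ hV.isCompact.isClosed hKΩ hUK hψ hψc hψU)|
      ≤ 6 * (C / ε * (H * ε ^ α) * (H * ε ^ α)) * L * volume.real (closure U) := by
  have hc : ∀ i, Continuous (pderivPlane i V) := continuous_pderivPlane hV.contDiff
  have hsm : ∀ {h : Plane → ℝ}, Continuous h → ContDiff ℝ ∞ (mollify ρ h) := fun hh =>
    contDiff_mollify hρ.contDiff hρ.hasCompactSupport hh
  have hVs := hsm hV.contDiff.continuous
  have hm : ∀ i, mollify ρ (pderivPlane i V) = pderivPlane i (mollify ρ V) := fun i =>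
    funext fun x => (pderivPlane_mollify_right hρ.continuous hV.contDiff
      hV.hasCompactSupport i x).symm
  have hab : ∀ x, pderivPlane 1 (mollify ρ (pderivPlane 0 V)) x
      = pderivPlane 0 (mollify ρ (pderivPlane 1 V)) x := fun x => by
    rw [hm, hm, pderivPlane_comm hVs]
  rw [veryWeakHessianDet_mollify hv hV hKΩ hρ hUK hψ hψc hψU,
    ← hessianForm_gradient_eq hψ hψc (hsm (hc 0)) (hsm (hc 1)) hab]
  set B := H * ε ^ α with hBdef
  have hB : 0 ≤ B := mul_nonneg hH (Real.rpow_nonneg hε.le _)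
  have hosc : ∀ i, ∀ x ∈ U, ∀ z ∈ Metric.closedBall x ε,
      |pderivPlane i V z - pderivPlane i V x| ≤ B := by
    intro i x hx z hz
    have hb := hUK x (subset_closure hx)
    refine (hV.holder x (hb (Metric.mem_closedBall_self hε.le)) z (hb hz) i).trans ?_
    exact mul_le_mul_of_nonneg_left (Real.rpow_le_rpow dist_nonneg hz hα) hH
  set D := 3 * (C / ε * B * B) with hD
  have hD0 : 0 ≤ D := by positivity
  have key : ∀ i j k l, |(∫ x, pderivPlane k (fun z => mollify ρ (pderivPlane i V) z
        * mollify ρ (pderivPlane j V) z) x * pderivPlane l ψ x)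
      - ∫ x, pderivPlane k (mollify ρ fun z => pderivPlane i V z * pderivPlane j V z) x
        * pderivPlane l ψ x| ≤ D * L * volume.real (closure U) := by
    intro i j k l
    refine abs_integral_pderivPlane_mul_sub_le hψ hψc hψU hU ((hsm (hc i)).mul (hsm (hc j)))
      (hsm ((hc i).mul (hc j))) (fun x hx => ?_) (fun x hx => hL x hx l) hL0 hD0
    rw [abs_sub_comm]
    exact hρ.abs_pderivPlane_commutator_le (hc i) (hc j) hB (hosc i x hx) (hosc j x hx)
  have k1 := abs_le.1 (key 0 0 1 1)
  have k2 := abs_le.1 (key 1 1 0 0)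
  have k3 := abs_le.1 (key 0 1 1 0)
  have k4 := abs_le.1 (key 0 1 0 1)
  -- Four commutator errors with the prefactor 1/2 give twice the single bound.
  have e : 6 * (C / ε * B * B) * L * volume.real (closure U)
      = 2 * (D * L * volume.real (closure U)) := by rw [hD]; ring
  rw [e, hessianForm, hessianForm, abs_le]
  constructor <;> linarith [k1.1, k1.2, k2.1, k2.2, k3.1, k3.2, k4.1, k4.2]

end Defect

/-! ### Perturbation of a planar field by an infinitesimal rotation -/

/-- The field `(p, q) + δ x^⊥`. -/
noncomputable def rotatedField (p q : Plane → ℝ) (δ : ℝ) (x : Plane) : Plane :=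
  !₂[p x - δ * x 1, q x + δ * x 0]

theorem contDiff_rotatedField {p q : Plane → ℝ} {n : ℕ∞ω} (hp : ContDiff ℝ n p)
    (hq : ContDiff ℝ n q) (δ : ℝ) : ContDiff ℝ n (rotatedField p q δ) := by
  rw [contDiff_euclidean]
  have h : ∀ j : Fin 2, ContDiff ℝ n fun x : Plane => x j := fun j =>
    (EuclideanSpace.proj j : Plane →L[ℝ] ℝ).contDiff
  intro i
  fin_cases i
  · exact hp.sub (contDiff_const.mul (h 1))
  · exact hq.add (contDiff_const.mul (h 0))

theorem pderivPlane_coord (i j : Fin 2) (x : Plane) :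
    pderivPlane i (fun z => z j) x = if i = j then 1 else 0 := by
  have := (EuclideanSpace.proj j : Plane →L[ℝ] ℝ).hasFDerivAt (x := x)
  change fderiv ℝ (EuclideanSpace.proj j : Plane →L[ℝ] ℝ) x (coordVec i) = _
  rw [this.fderiv]
  simp [coordVec, eq_comm]

section RotatedField

variable {p q : Plane → ℝ} {x : Plane} (δ : ℝ)

theorem pderivPlane_rotatedField_zero (hp : DifferentiableAt ℝ p x) (i : Fin 2) :
    pderivPlane i (fun z => rotatedField p q δ z 0) x
      = pderivPlane i p x - δ * if i = 1 then 1 else 0 := by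
  have h1 : DifferentiableAt ℝ (fun z : Plane => z 1) x :=
    (EuclideanSpace.proj 1 : Plane →L[ℝ] ℝ).differentiableAt
  change pderivPlane i (fun z => p z - δ * z 1) x = _
  rw [pderivPlane_sub hp (h1.const_mul δ), pderivPlane_const_mul δ h1, pderivPlane_coord]

theorem pderivPlane_rotatedField_one (hq : DifferentiableAt ℝ q x) (i : Fin 2) :
    pderivPlane i (fun z => rotatedField p q δ z 1) x
      = pderivPlane i q x + δ * if i = 0 then 1 else 0 := by
  have h1 : DifferentiableAt ℝ (fun z : Plane => z 0) x :=
    (EuclideanSpace.proj 0 : Plane →L[ℝ] ℝ).differentiableAt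
  change pderivPlane i (fun z => q z + δ * z 0) x = _
  rw [pderivPlane_add hq (h1.const_mul δ), pderivPlane_const_mul δ h1, pderivPlane_coord]

/-- The terms linear in δ pair a symmetric matrix with an antisymmetric one and cancel; the gain δ²
has the same sign for either sign of δ. -/
theorem det_fderiv_rotatedField (hp : ContDiff ℝ ∞ p) (hq : ContDiff ℝ ∞ q)
    (hpq : pderivPlane 1 p x = pderivPlane 0 q x) :
    (fderiv ℝ (rotatedField p q δ) x).det
      = (pderivPlane 0 p x * pderivPlane 1 q x - pderivPlane 1 p x * pderivPlane 0 q x)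
        + δ ^ 2 := by
  have hp' : DifferentiableAt ℝ p x := (hp.differentiable (by simp)).differentiableAt
  have hq' : DifferentiableAt ℝ q x := (hq.differentiable (by simp)).differentiableAt
  rw [det_fderiv_plane ((contDiff_rotatedField hp hq δ).differentiable (by simp)).differentiableAt]
  simp only [pderivPlane_rotatedField_zero δ hp', pderivPlane_rotatedField_one δ hq']
  simp only [if_true, zero_ne_one, one_ne_zero, if_false, hpq]
  ring

theorem dist_rotatedField_le (p q p' q' : Plane → ℝ) (x : Plane) :
    dist (rotatedField p q δ x) (rotatedField p' q' δ x) ≤ |p x - p' x| + |q x - q' x| := by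
  rw [EuclideanSpace.dist_eq, Fin.sum_univ_two, Real.dist_eq, Real.dist_eq]
  have e0 : rotatedField p q δ x 0 - rotatedField p' q' δ x 0 = p x - p' x := by
    simp [rotatedField]
  have e1 : rotatedField p q δ x 1 - rotatedField p' q' δ x 1 = q x - q' x := by
    simp [rotatedField]
  rw [e0, e1]
  refine Real.sqrt_le_iff.2 ⟨by positivity, ?_⟩
  nlinarith [abs_nonneg (p x - p' x), abs_nonneg (q x - q' x)]

end RotatedField

/-! ### Uniform convergence of mollifications -/

theorem IsMollifier.eventually_abs_mollify_sub_le {ρ : ℕ → Plane → ℝ} {ε : ℕ → ℝ} {C : ℝ}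
    (hρ : ∀ n, IsMollifier (ρ n) (ε n) C) (hε : Tendsto ε atTop (𝓝 0)) {h : Plane → ℝ}
    (hh : Continuous h) (hhc : HasCompactSupport h) {τ : ℝ} (hτ : 0 < τ) :
    ∀ᶠ n in atTop, ∀ x, |mollify (ρ n) h x - h x| ≤ τ := by
  have huc : UniformContinuous h := hhc.uniformContinuous_of_continuous hh
  obtain ⟨r, hr, hrτ⟩ := Metric.uniformContinuous_iff.1 huc τ hτ
  filter_upwards [hε.eventually (gt_mem_nhds hr)] with n hn x
  exact (hρ n).abs_mollify_sub_le hh hτ.le fun z hz =>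
    (hrτ ((Metric.mem_ball.1 hz).trans hn)).le

theorem tendsto_integral_of_bounded_of_support {ν : Measure Plane} {S : Set Plane}
    (hS : IsCompact S) (hν : ν S < ⊤) {s : ℕ → Plane → ℝ} {s' : Plane → ℝ} {M : ℝ}
    (hc : ∀ n, Continuous (s n)) (hM : ∀ n x, |s n x| ≤ M) (h0 : ∀ n, ∀ x ∉ S, s n x = 0)
    (hlim : ∀ x, Tendsto (fun n => s n x) atTop (𝓝 (s' x))) :
    Tendsto (fun n => ∫ x, s n x ∂ν) atTop (𝓝 (∫ x, s' x ∂ν)) := by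
  refine tendsto_integral_of_dominated_convergence (S.indicator fun _ => M)
    (fun n => (hc n).aestronglyMeasurable) ?_ (fun n => ae_of_all _ fun x => ?_)
    (ae_of_all _ hlim)
  · exact (integrable_indicator_iff hS.measurableSet).2 (integrableOn_const hν.ne)
  · by_cases hx : x ∈ S
    · rw [indicator_of_mem hx]; exact hM n x
    · rw [indicator_of_notMem hx, h0 n x hx, norm_zero]

/-! ### Passage to the limit in the degree integral -/

theorem HasCompactSupport.exists_abs_le {f : Plane → ℝ} (hfc : HasCompactSupport f)
    (hf : Continuous f) : ∃ M, 0 ≤ M ∧ ∀ x, |f x| ≤ M := by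
  obtain ⟨M, hM⟩ := hf.bounded_above_of_compact_support hfc
  exact ⟨M, (norm_nonneg _).trans (hM 0), hM⟩

/-- The defect bound tends to zero since `3 α - 2 > 0`. -/
theorem tendsto_defect_bound {α : ℝ} (hα : 2 / 3 < α) {ε : ℕ → ℝ} (hε0 : ∀ n, 0 < ε n)
    (hε : Tendsto ε atTop (𝓝 0)) (C H a b V : ℝ) :
    Tendsto (fun n => 6 * (C / ε n * (H * ε n ^ α) * (H * ε n ^ α))
      * (a * (C / ε n * (H * ε n ^ α)) + b) * V) atTop (𝓝 0) := by
  have hr : ∀ s : ℝ, 0 < s → Tendsto (fun n => ε n ^ s) atTop (𝓝 0) := fun s hs => by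
    have := hε.rpow_const (p := s) (Or.inr hs.le)
    rwa [Real.zero_rpow hs.ne'] at this
  have e : ∀ n, 6 * (C / ε n * (H * ε n ^ α) * (H * ε n ^ α))
      * (a * (C / ε n * (H * ε n ^ α)) + b) * V
      = (6 * C ^ 2 * H ^ 3 * a * V) * ε n ^ (3 * α - 2) + (6 * C * H ^ 2 * b * V)
        * ε n ^ (2 * α - 1) := by
    intro n
    have h := hε0 n
    have e1 : ε n ^ (3 * α - 2) = ε n ^ α * ε n ^ α * ε n ^ α / (ε n * ε n) := by
      rw [Real.rpow_sub h, ← Real.rpow_add h, ← Real.rpow_add h]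
      congr 1
      · ring_nf
      · rw [Real.rpow_two, sq]
    have e2 : ε n ^ (2 * α - 1) = ε n ^ α * ε n ^ α / ε n := by
      rw [Real.rpow_sub h, ← Real.rpow_add h, Real.rpow_one]
      ring_nf
    rw [e1, e2]
    field_simp
  simp only [e]
  have := ((hr (3 * α - 2) (by linarith)).const_mul (6 * C ^ 2 * H ^ 3 * a * V)).add
    ((hr (2 * α - 1) (by linarith)).const_mul (6 * C * H ^ 2 * b * V))
  simpa using this

section Limit

variable {v V : Plane → ℝ} {U K : Set Plane} {ε₀ H α : ℝ} {Ω : Opens Plane}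

theorem IsLocalPotential.exists_approximation (hV : IsLocalPotential v V U K ε₀ H α) (hε₀ : 0 < ε₀) :
    ∃ (C : ℝ) (ε : ℕ → ℝ) (ρ : ℕ → Plane → ℝ), 0 ≤ C ∧ (∀ n, 0 < ε n) ∧ (∀ n, ε n ≤ ε₀) ∧
      Tendsto ε atTop (𝓝 0) ∧ (∀ n, IsMollifier (ρ n) (ε n) C) ∧
      ∀ δ, ∀ τ > 0, ∀ᶠ n in atTop, ∀ x,
        dist (rotatedField (mollify (ρ n) (pderivPlane 0 V)) (mollify (ρ n) (pderivPlane 1 V)) δ x)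
          (rotatedField (pderivPlane 0 V) (pderivPlane 1 V) δ x) < τ := by
  obtain ⟨C, hC, hex⟩ := exists_isMollifier
  have hpos : ∀ n : ℕ, 0 < ε₀ / (n + 1) := fun n => by positivity
  choose ρ hρ using fun n : ℕ => hex (ε₀ / (n + 1)) (hpos n)
  have hlim : Tendsto (fun n : ℕ => ε₀ / (n + 1)) atTop (𝓝 0) := by
    have := (tendsto_one_div_add_atTop_nhds_zero_nat (𝕜 := ℝ)).const_mul ε₀
    simpa [div_eq_mul_inv] using this
  refine ⟨C, fun n => ε₀ / (n + 1), ρ, hC, hpos, fun n => ?_, hlim, hρ, fun δ τ hτ => ?_⟩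
  · exact div_le_self hε₀.le (by have := n.cast_nonneg (α := ℝ); linarith)
  · have key := fun i => IsMollifier.eventually_abs_mollify_sub_le hρ hlim
      (continuous_pderivPlane hV.contDiff i) (hV.hasCompactSupport.pderivPlane i)
      (by positivity : 0 < τ / 3)
    filter_upwards [key 0, key 1] with n h0 h1 x
    refine (dist_rotatedField_le δ _ _ _ _ x).trans_lt ?_
    linarith [h0 x, h1 x]

theorem IsLocalPotential.exists_smooth_approximation (hV : IsLocalPotential v V U K ε₀ H α)
    (hε₀ : 0 < ε₀) {η : ℝ} (hη : 0 < η) :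
    ∃ w : Plane → Plane, ContDiff ℝ ∞ w ∧ ∀ x ∈ closure U, dist (w x) (gradient v x) < η := by
  obtain ⟨C, ε, ρ, -, -, -, -, hρ, happ⟩ := hV.exists_approximation hε₀
  obtain ⟨n, hn⟩ := (happ 0 η hη).exists
  have hs : ∀ i, ContDiff ℝ ∞ (mollify (ρ n) (pderivPlane i V)) := fun i =>
    contDiff_mollify (hρ n).contDiff (hρ n).hasCompactSupport (continuous_pderivPlane hV.contDiff i)
  refine ⟨_, contDiff_rotatedField (hs 0) (hs 1) 0, fun x hx => ?_⟩
  have hxK : x ∈ K := hV.closedBall_subset x hx (Metric.mem_closedBall_self hε₀.le)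
  have e : rotatedField (pderivPlane 0 V) (pderivPlane 1 V) 0 x = gradient v x := by
    ext i
    fin_cases i
    · simp [rotatedField, hV.pderivPlane_eq x hxK]
    · simp [rotatedField, hV.pderivPlane_eq x hxK]
  rw [← e]
  exact hn x

/-- The degree integrals of the mollified perturbed gradients converge to the integral against
`μ + δ² dx`. -/
theorem IsLocalPotential.exists_tendsto_degree_integral (hv : ContinuousOn (gradient v) Ω)
    (hV : IsLocalPotential v V U K ε₀ H α) (hε₀ : 0 < ε₀) (hH : 0 ≤ H) (hα : 2 / 3 < α)
    (hKΩ : K ⊆ Ω) (hU : IsCompact (closure U)) {μ : Measure Plane}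
    (hμ : IsInducedMeasure (veryWeakHessianDet Ω v) μ) (δ : ℝ)
    {χ g : Plane → ℝ} (hχ : ContDiff ℝ ∞ χ) (hχc : HasCompactSupport χ) (hχU : tsupport χ ⊆ U)
    (hg : ContDiff ℝ ∞ g) (hgc : HasCompactSupport g) :
    ∃ W : ℕ → Plane → Plane, (∀ n, ContDiff ℝ ∞ (W n)) ∧
      (∀ τ > 0, ∀ᶠ n in atTop, ∀ x,
        dist (W n x) (rotatedField (pderivPlane 0 V) (pderivPlane 1 V) δ x) < τ) ∧
      Tendsto (fun n => ∫ x, χ x * (g (W n x) * (fderiv ℝ (W n) x).det)) atTop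
        (𝓝 ((∫ x, χ x * g (rotatedField (pderivPlane 0 V) (pderivPlane 1 V) δ x) ∂μ)
          + δ ^ 2 * ∫ x, χ x * g (rotatedField (pderivPlane 0 V) (pderivPlane 1 V) δ x))) := by
  obtain ⟨C, ε, ρ, hC, hε0, hεε₀, hε, hρ, happ⟩ := hV.exists_approximation hε₀
  set F := rotatedField (pderivPlane 0 V) (pderivPlane 1 V) δ with hF
  have hc : ∀ i, Continuous (pderivPlane i V) := continuous_pderivPlane hV.contDiff
  have hFc : Continuous F :=
    (contDiff_rotatedField (n := 0) (contDiff_zero.2 (hc 0)) (contDiff_zero.2 (hc 1)) δ).continuous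
  have hs : ∀ n i, ContDiff ℝ ∞ (mollify (ρ n) (pderivPlane i V)) := fun n i =>
    contDiff_mollify (hρ n).contDiff (hρ n).hasCompactSupport (hc i)
  let W : ℕ → Plane → Plane := fun n =>
    rotatedField (mollify (ρ n) (pderivPlane 0 V)) (mollify (ρ n) (pderivPlane 1 V)) δ
  have hW : ∀ n, ContDiff ℝ ∞ (W n) := fun n => contDiff_rotatedField (hs n 0) (hs n 1) δ
  have hWF : ∀ τ > 0, ∀ᶠ n in atTop, ∀ x, dist (W n x) (F x) < τ := happ δ
  refine ⟨W, hW, hWF, ?_⟩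
  let ψ : ℕ → Plane → ℝ := fun n x => χ x * g (W n x)
  let ψ' : Plane → ℝ := fun x => χ x * g (F x)
  have hψ : ∀ n, ContDiff ℝ ∞ (ψ n) := fun n => hχ.mul (hg.comp (hW n))
  have hψc : ∀ n, HasCompactSupport (ψ n) := fun n => hχc.mul_right
  have hψU : ∀ n, tsupport (ψ n) ⊆ U := fun n => (tsupport_mul_subset_left).trans hχU
  have hψ'c : Continuous ψ' := hχ.continuous.mul (hg.continuous.comp hFc)
  obtain ⟨X₀, hX₀, hχ0⟩ := hχc.exists_abs_le hχ.continuous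
  obtain ⟨G₀, hG₀, hg0⟩ := hgc.exists_abs_le hg.continuous
  have hψb : ∀ n x, |ψ n x| ≤ X₀ * G₀ := fun n x => by
    rw [abs_mul]; exact mul_le_mul (hχ0 x) (hg0 _) (abs_nonneg _) hX₀
  -- uniform convergence of the test functions
  have hunif : ∀ τ > 0, ∀ᶠ n in atTop, ∀ x, |ψ n x - ψ' x| ≤ τ := by
    intro τ hτ
    have huc : UniformContinuous g := hgc.uniformContinuous_of_continuous hg.continuous
    obtain ⟨r, hr, hrτ⟩ := Metric.uniformContinuous_iff.1 huc (τ / (X₀ + 1)) (by positivity)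
    filter_upwards [hWF r hr] with n hn x
    have h1 : |g (W n x) - g (F x)| ≤ τ / (X₀ + 1) := (hrτ (hn x)).le
    calc |ψ n x - ψ' x| = |χ x| * |g (W n x) - g (F x)| := by
          rw [← abs_mul, mul_sub]
      _ ≤ X₀ * (τ / (X₀ + 1)) := mul_le_mul (hχ0 x) h1 (abs_nonneg _) hX₀
      _ ≤ τ := by
          rw [mul_div_assoc', div_le_iff₀ (by positivity)]
          nlinarith
  have hvol : Tendsto (fun n => ∫ x, ψ n x) atTop (𝓝 (∫ x, ψ' x)) := by
    refine tendsto_integral_of_bounded_of_support hχc.isCompact hχc.isCompact.measure_lt_top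
      (fun n => (hψ n).continuous) hψb (fun n x hx => ?_) fun x => ?_
    · change χ x * _ = 0
      rw [image_eq_zero_of_notMem_tsupport hx, zero_mul]
    · rw [Metric.tendsto_atTop']
      intro τ hτ
      obtain ⟨N, hN⟩ := eventually_atTop.1 (hunif (τ / 2) (by positivity))
      exact ⟨N, fun n hn => ((hN n hn.le) x).trans_lt (by linarith)⟩
  have hUK : ∀ n, ∀ x ∈ closure U, Metric.closedBall x (ε n) ⊆ K := fun n x hx =>
    (Metric.closedBall_subset_closedBall (hεε₀ n)).trans (hV.closedBall_subset x hx)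
  let φ : ℕ → 𝓓(Ω, ℝ) := fun n => mollifiedTestFunction (hρ n) hV.isCompact.isClosed hKΩ (hUK n)
    (hψ n) (hψc n) (hψU n)
  -- Dominated convergence for μ: the mollified test functions are uniformly bounded, supported in
  -- K, which has finite μ-measure, and converge pointwise to ψ'.
  have hfφ : Tendsto (fun n => veryWeakHessianDet Ω v (φ n)) atTop (𝓝 (∫ x, ψ' x ∂μ)) := by
    simp only [← hμ.integral_eq]
    refine tendsto_integral_of_bounded_of_support (M := X₀ * G₀) hV.isCompact
      (hμ.lt_top_of_isCompact K hV.isCompact hKΩ) (fun n => (φ n).continuous) (fun n x => ?_)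
      (fun n x hx => ?_) fun x => ?_
    · have := (hρ n).abs_mollify_sub_le (hψ n).continuous (x := x) (c := 0) (mul_nonneg hX₀ hG₀)
        fun z _ => by rw [sub_zero]; exact hψb n z
      rwa [sub_zero] at this
    · exact image_eq_zero_of_notMem_tsupport fun h => hx
        (tsupport_mollify_subset (hρ n) hV.isCompact.isClosed (hUK n) (hψU n) h)
    · rw [Metric.tendsto_atTop']
      intro τ hτ
      obtain ⟨r, hr, hrx⟩ := Metric.continuous_iff.1 hψ'c x (τ / 4) (by positivity)
      obtain ⟨N, hN⟩ := eventually_atTop.1 ((hunif (τ / 4) (by positivity)).and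
        (hε.eventually (gt_mem_nhds hr)))
      refine ⟨N, fun n hn => ?_⟩
      have h1 := (hρ n).abs_mollify_sub_le (hψ n).continuous (x := x) (c := ψ' x)
        (by positivity : 0 ≤ τ / 2) fun z hz => by
          have h2 := (hN n hn.le).1 z
          have h3 : |ψ' z - ψ' x| < τ / 4 := hrx z ((Metric.mem_ball.1 hz).trans (hN n hn.le).2)
          have h4 := abs_sub_le (ψ n z) (ψ' z) (ψ' x)
          linarith
      exact lt_of_le_of_lt h1 (by linarith)
  -- the defect tends to zero
  obtain ⟨X₁, hX₁, hχ1⟩ : ∃ X₁, 0 ≤ X₁ ∧ ∀ i x, |pderivPlane i χ x| ≤ X₁ := by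
    obtain ⟨A, hA, hA'⟩ := (hχc.pderivPlane 0).exists_abs_le (contDiff_pderivPlane hχ 0).continuous
    obtain ⟨B, hB, hB'⟩ := (hχc.pderivPlane 1).exists_abs_le (contDiff_pderivPlane hχ 1).continuous
    refine ⟨A + B, by positivity, fun i x => ?_⟩
    fin_cases i
    · exact (hA' x).trans (by linarith)
    · exact (hB' x).trans (by linarith)
  obtain ⟨G₁, hG₁, hg1⟩ : ∃ G₁, 0 ≤ G₁ ∧ ∀ i x, |pderivPlane i g x| ≤ G₁ := by
    obtain ⟨A, hA, hA'⟩ := (hgc.pderivPlane 0).exists_abs_le (contDiff_pderivPlane hg 0).continuous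
    obtain ⟨B, hB, hB'⟩ := (hgc.pderivPlane 1).exists_abs_le (contDiff_pderivPlane hg 1).continuous
    refine ⟨A + B, by positivity, fun i x => ?_⟩
    fin_cases i
    · exact (hA' x).trans (by linarith)
    · exact (hB' x).trans (by linarith)
  let P : ℕ → ℝ := fun n => C / ε n * (H * ε n ^ α)
  have hP0 : ∀ n, 0 ≤ P n := fun n => by
    have := hε0 n
    have := Real.rpow_nonneg this.le α
    positivity
  have hpdW : ∀ n, ∀ x ∈ U, ∀ i j, |pderivPlane j (mollify (ρ n) (pderivPlane i V)) x| ≤ P n := by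
    intro n x hx i j
    have hb := hUK n x (subset_closure hx)
    have hr := Real.rpow_nonneg (hε0 n).le α
    refine (hρ n).abs_pderivPlane_mollify_le (hc i) (c := pderivPlane i V x) (by positivity)
      fun z hz => ?_
    refine (hV.holder x (hb (Metric.mem_closedBall_self (hε0 n).le)) z (hb hz) i).trans ?_
    exact mul_le_mul_of_nonneg_left (Real.rpow_le_rpow dist_nonneg hz (by linarith)) hH
  -- The test functions depend on the mollified field, so their gradients blow up like P n, of order
  -- ε^(α-1). The factor 2 counts the two components in the chain rule.
  have hL : ∀ n, ∀ x ∈ U, ∀ j, |pderivPlane j (ψ n) x|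
      ≤ (2 * X₀ * G₁) * P n + (2 * X₀ * G₁ * |δ| + G₀ * X₁) := by
    intro n x hx j
    have hd : ∀ i, DifferentiableAt ℝ (mollify (ρ n) (pderivPlane i V)) x := fun i =>
      ((hs n i).differentiable (by simp)).differentiableAt
    have hχd : DifferentiableAt ℝ χ x := (hχ.differentiable (by simp)).differentiableAt
    have hgd : DifferentiableAt ℝ g (W n x) := (hg.differentiable (by simp)).differentiableAt
    have hWd : DifferentiableAt ℝ (W n) x := ((hW n).differentiable (by simp)).differentiableAt
    have hite : ∀ k : Fin 2, |δ * (if j = k then (1 : ℝ) else 0)| ≤ |δ| := fun k => by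
      split_ifs <;> simp
    have b0 : |pderivPlane j (fun z => W n z 0) x| ≤ P n + |δ| := by
      rw [pderivPlane_rotatedField_zero δ (hd 0)]
      exact (abs_sub _ _).trans (add_le_add (hpdW n x hx 0 j) (hite 1))
    have b1 : |pderivPlane j (fun z => W n z 1) x| ≤ P n + |δ| := by
      rw [pderivPlane_rotatedField_one δ (hd 1)]
      exact (abs_add_le _ _).trans (add_le_add (hpdW n x hx 1 j) (hite 0))
    have hψe : pderivPlane j (ψ n) x = _ :=
      pderivPlane_mul hχd (hgd.comp x hWd : DifferentiableAt ℝ (fun z => g (W n z)) x)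
    rw [hψe, pderivPlane_comp hgd hWd]
    have c0 : |pderivPlane 0 g (W n x) * pderivPlane j (fun z => W n z 0) x|
        ≤ G₁ * (P n + |δ|) := by
      rw [abs_mul]; exact mul_le_mul (hg1 0 _) b0 (abs_nonneg _) hG₁
    have c1 : |pderivPlane 1 g (W n x) * pderivPlane j (fun z => W n z 1) x|
        ≤ G₁ * (P n + |δ|) := by
      rw [abs_mul]; exact mul_le_mul (hg1 1 _) b1 (abs_nonneg _) hG₁
    refine (abs_add_le _ _).trans ?_
    rw [abs_mul, abs_mul (g _)]
    have c2 := mul_le_mul (hχ0 x) ((abs_add_le _ _).trans (add_le_add c0 c1)) (abs_nonneg _) hX₀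
    have c3 := mul_le_mul (hg0 (W n x)) (hχ1 j x) (abs_nonneg _) hG₀
    linarith
  let A : ℕ → ℝ := fun n => ∫ x, ψ n x * (pderivPlane 0 (mollify (ρ n) (pderivPlane 0 V)) x
          * pderivPlane 1 (mollify (ρ n) (pderivPlane 1 V)) x
        - pderivPlane 1 (mollify (ρ n) (pderivPlane 0 V)) x
          * pderivPlane 0 (mollify (ρ n) (pderivPlane 1 V)) x)
  have hdefect : ∀ n, |A n - veryWeakHessianDet Ω v (φ n)|
      ≤ 6 * (C / ε n * (H * ε n ^ α) * (H * ε n ^ α))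
        * ((2 * X₀ * G₁) * (C / ε n * (H * ε n ^ α)) + (2 * X₀ * G₁ * |δ| + G₀ * X₁))
        * volume.real (closure U) := fun n =>
    abs_integral_hessian_sub_veryWeakHessianDet_le hv hV hH (by linarith) hKΩ (hρ n) (hε0 n) hC hU
      (hUK n) (hψ n) (hψc n) (hψU n) (by have := hP0 n; positivity) (hL n)
  have hA : Tendsto A atTop (𝓝 (∫ x, ψ' x ∂μ)) := by
    have h0 := squeeze_zero_norm (f := fun n => A n - veryWeakHessianDet Ω v (φ n))
      (fun n => hdefect n)
      (tendsto_defect_bound hα hε0 hε C H (2 * X₀ * G₁) (2 * X₀ * G₁ * |δ| + G₀ * X₁)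
        (volume.real (closure U)))
    have := h0.add hfφ
    simpa using this
  have hfinal : ∀ n, ∫ x, χ x * (g (W n x) * (fderiv ℝ (W n) x).det)
      = A n + δ ^ 2 * ∫ x, ψ n x := by
    intro n
    have hm : ∀ i, mollify (ρ n) (pderivPlane i V) = pderivPlane i (mollify (ρ n) V) := fun i =>
      funext fun x => (pderivPlane_mollify_right (hρ n).continuous hV.contDiff
        hV.hasCompactSupport i x).symm
    have hVs : ContDiff ℝ ∞ (mollify (ρ n) V) :=
      contDiff_mollify (hρ n).contDiff (hρ n).hasCompactSupport hV.contDiff.continuous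
    have hab : ∀ x, pderivPlane 1 (mollify (ρ n) (pderivPlane 0 V)) x
        = pderivPlane 0 (mollify (ρ n) (pderivPlane 1 V)) x := fun x => by
      rw [hm, hm, pderivPlane_comm hVs]
    have q : ∀ i j, Continuous (pderivPlane j (mollify (ρ n) (pderivPlane i V))) := fun i j =>
      (contDiff_pderivPlane (hs n i) j).continuous
    rw [← integral_const_mul, ← integral_add]
    · refine integral_congr_ae (ae_of_all _ fun x => ?_)
      change χ x * (g (W n x) * (fderiv ℝ (rotatedField _ _ δ) x).det) = _
      rw [det_fderiv_rotatedField δ (hs n 0) (hs n 1) (hab x)]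
      simp only [ψ]
      ring
    · exact ((hψ n).continuous.mul (((q 0 0).mul (q 1 1)).sub
        ((q 0 1).mul (q 1 0)))).integrable_of_hasCompactSupport (hψc n).mul_right
    · exact ((hψ n).continuous.integrable_of_hasCompactSupport (hψc n)).const_mul _
  simp only [hfinal]
  exact hA.add (hvol.const_mul _)

end Limit

/-! ### The local degree formula -/

/-- Settles separately the case excluded by the nonemptiness assumption of the degree formula. -/
theorem brouwerDegree_empty (u : Plane → Plane) (y : Plane) : brouwerDegree u ∅ y = 0 := by
  rw [brouwerDegree]
  split_ifs with h
  · simp [regularDegree]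
  · rfl

section Formula

variable {v V : Plane → ℝ} {U K : Set Plane} {ε₀ H α : ℝ} {Ω : Opens Plane}

theorem IsLocalPotential.dist_rotatedField_gradient_le (hV : IsLocalPotential v V U K ε₀ H α)
    (hε₀ : 0 < ε₀) (δ : ℝ) {x : Plane} (hx : x ∈ closure U) :
    dist (rotatedField (pderivPlane 0 V) (pderivPlane 1 V) δ x) (gradient v x) ≤ |δ| * (2 * ‖x‖) := by
  have hxK : x ∈ K := hV.closedBall_subset x hx (Metric.mem_closedBall_self hε₀.le)
  have h0 := PiLp.norm_apply_le x 0
  have h1 := PiLp.norm_apply_le x 1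
  -- Writing the gradient as a rotated field with the same δ allows `dist_rotatedField_le` to
  -- compare the two.
  have e : gradient v x = rotatedField (fun z => pderivPlane 0 V z + δ * z 1)
      (fun z => pderivPlane 1 V z - δ * z 0) δ x := by
    ext i
    fin_cases i
    · simp [rotatedField, hV.pderivPlane_eq x hxK]
    · simp [rotatedField, hV.pderivPlane_eq x hxK]
  rw [e]
  refine (dist_rotatedField_le δ _ _ _ _ x).trans ?_
  have e0 : pderivPlane 0 V x - (pderivPlane 0 V x + δ * x 1) = -(δ * x 1) := by ring
  have e1 : pderivPlane 1 V x - (pderivPlane 1 V x - δ * x 0) = δ * x 0 := by ring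
  rw [e0, e1, abs_neg, abs_mul, abs_mul, ← mul_add]
  refine mul_le_mul_of_nonneg_left ?_ (abs_nonneg δ)
  rw [Real.norm_eq_abs] at h0 h1
  linarith

theorem IsLocalPotential.rotatedField_zero_eq_gradient (hV : IsLocalPotential v V U K ε₀ H α)
    (hε₀ : 0 < ε₀) {x : Plane} (hx : x ∈ closure U) :
    rotatedField (pderivPlane 0 V) (pderivPlane 1 V) 0 x = gradient v x := by
  have := hV.dist_rotatedField_gradient_le hε₀ 0 hx
  rw [abs_zero, zero_mul] at this
  exact dist_le_zero.1 this

theorem IsLocalPotential.continuous_rotatedField (hV : IsLocalPotential v V U K ε₀ H α) (δ : ℝ) :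
    Continuous (rotatedField (pderivPlane 0 V) (pderivPlane 1 V) δ) :=
  (contDiff_rotatedField (n := 0) (contDiff_zero.2 (continuous_pderivPlane hV.contDiff 0))
    (contDiff_zero.2 (continuous_pderivPlane hV.contDiff 1)) δ).continuous

/-- The degree formula near a point `y ∉ ∇v(∂U)`, for the gradient perturbed by a small
infinitesimal rotation. -/
theorem IsLocalPotential.exists_degree_formula (hv : ContinuousOn (gradient v) Ω)
    (hV : IsLocalPotential v V U K ε₀ H α) (hε₀ : 0 < ε₀) (hH : 0 ≤ H) (hα : 2 / 3 < α)
    (hKΩ : K ⊆ Ω) (hUo : IsOpen U) (hU : IsCompact (closure U)) (hUΩ : closure U ⊆ Ω)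
    (hne : U.Nonempty) {μ : Measure Plane} (hμ : IsInducedMeasure (veryWeakHessianDet Ω v) μ)
    {y : Plane} (hy : y ∉ gradient v '' frontier U) :
    ∃ η > 0, ∀ δ : ℝ, (∀ x ∈ closure U, dist
        (rotatedField (pderivPlane 0 V) (pderivPlane 1 V) δ x) (gradient v x) < η / 2) →
      ∀ g : Plane → ℝ, ContDiff ℝ ∞ g → support g ⊆ Metric.ball y η →
        (brouwerDegree (gradient v) U y : ℝ) * ∫ z, g z
          = (∫ x in U, g (rotatedField (pderivPlane 0 V) (pderivPlane 1 V) δ x) ∂μ)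
            + δ ^ 2 * ∫ x in U, g (rotatedField (pderivPlane 0 V) (pderivPlane 1 V) δ x) := by
  obtain ⟨η, hη, χ, hχ, hχc, hχU, hχ1, hdeg⟩ := exists_brouwerDegree_mul_integral_eq hUo hU hne
    (hv.mono hUΩ) hy fun η hη => hV.exists_smooth_approximation hε₀ hη
  refine ⟨η, hη, fun δ hδ g hg hgs => ?_⟩
  have hgc : HasCompactSupport g := HasCompactSupport.of_support_subset_isCompact
    (isCompact_closedBall y η) (hgs.trans Metric.ball_subset_closedBall)
  obtain ⟨W, hW, hWF, hlim⟩ := hV.exists_tendsto_degree_integral hv hε₀ hH hα hKΩ hU hμ δ hχ hχc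
    hχU hg hgc
  set F := rotatedField (pderivPlane 0 V) (pderivPlane 1 V) δ
  have hev : ∀ᶠ n in atTop, ∫ x, χ x * (g (W n x) * (fderiv ℝ (W n) x).det)
      = (brouwerDegree (gradient v) U y : ℝ) * ∫ z, g z := by
    filter_upwards [hWF (η / 2) (by positivity)] with n hn
    refine (hdeg (W n) (hW n) (fun x hx => ?_) g hg hgs).symm
    have := dist_triangle (W n x) (F x) (gradient v x)
    linarith [hn x, hδ x hx]
  -- The degree integrals are eventually constant, so their limit equals the degree times ∫ g.
  have h1 := tendsto_nhds_unique (tendsto_const_nhds.congr' (EventuallyEq.symm hev)) hlim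
  -- Where g(F) is nonzero on U, ∇v lies within η + η/2 < 2η of y, and there χ equals 1.
  have h2 : (fun x => χ x * g (F x)) = U.indicator fun x => g (F x) := by
    ext x
    by_cases hx : x ∈ U
    · rw [indicator_of_mem hx]
      by_cases hgx : g (F x) = 0
      · rw [hgx, mul_zero]
      · rw [hχ1 x (subset_closure hx), one_mul]
        have h3 : dist (F x) y < η := hgs hgx
        have := dist_triangle_left (gradient v x) y (F x)
        linarith [hδ x (subset_closure hx)]
    · rw [indicator_of_notMem hx, image_eq_zero_of_notMem_tsupport fun h => hx (hχU h), zero_mul]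
  rw [h1, h2, integral_indicator hUo.measurableSet, integral_indicator hUo.measurableSet]

/-- Points of `∇v(U) \ ∇v(∂U)` have degree at least one, and the degree is nonnegative. -/
theorem IsLocalPotential.indicator_le_brouwerDegree (hv : ContinuousOn (gradient v) Ω)
    (hV : IsLocalPotential v V U K ε₀ H α) (hε₀ : 0 < ε₀) (hH : 0 ≤ H) (hα : 2 / 3 < α)
    (hKΩ : K ⊆ Ω) (hUo : IsOpen U) (hU : IsCompact (closure U)) (hUΩ : closure U ⊆ Ω)
    (hne : U.Nonempty) {μ : Measure Plane} (hμ : IsInducedMeasure (veryWeakHessianDet Ω v) μ)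
    {y : Plane} (hy : y ∉ gradient v '' frontier U) :
    (gradient v '' U \ gradient v '' frontier U).indicator (fun _ => (1 : ℤ)) y
      ≤ brouwerDegree (gradient v) U y := by
  obtain ⟨η, hη, hformula⟩ := hV.exists_degree_formula hv hε₀ hH hα hKΩ hUo hU hUΩ hne hμ hy
  let g : ContDiffBump y := ⟨η / 2, η, by positivity, by linarith⟩
  have hgs : support g ⊆ Metric.ball y η := g.support_eq.subset
  have hgpos : 0 < ∫ z, g z := g.integral_pos
  by_cases hyU : y ∈ gradient v '' U
  · rw [indicator_of_mem (show y ∈ gradient v '' U \ gradient v '' frontier U from ⟨hyU, hy⟩)]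
    obtain ⟨x₀, hx₀, rfl⟩ := hyU
    obtain ⟨R, hR⟩ := hU.isBounded.exists_norm_le
    have hR0 : 0 ≤ R := (norm_nonneg x₀).trans (hR x₀ (subset_closure hx₀))
    -- A rotation this small moves ∇v by less than η/2 on the closure of U, which has norm at most
    -- R. That is both what the formula requires and the inner radius of the bump, so g(F x₀) = 1.
    obtain ⟨δ, hδ0, hδ⟩ : ∃ δ : ℝ, 0 < δ ∧ δ * (2 * R) < η / 2 := by
      refine ⟨η / 2 / (2 * R + 1), by positivity, ?_⟩
      rw [div_mul_eq_mul_div, div_lt_iff₀ (by positivity)]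
      nlinarith
    have hclose : ∀ x ∈ closure U, dist
        (rotatedField (pderivPlane 0 V) (pderivPlane 1 V) δ x) (gradient v x) < η / 2 := by
      intro x hx
      refine (hV.dist_rotatedField_gradient_le hε₀ δ hx).trans_lt (lt_of_le_of_lt ?_ hδ)
      rw [abs_of_pos hδ0]
      exact mul_le_mul_of_nonneg_left (by linarith [hR x hx]) hδ0.le
    have e := hformula δ hclose g g.contDiff hgs
    have hFc := hV.continuous_rotatedField δ
    set F := rotatedField (pderivPlane 0 V) (pderivPlane 1 V) δ
    have hgF : Continuous fun x => g (F x) := g.continuous.comp hFc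
    have hpos : 0 < ∫ x in U, g (F x) := by
      rw [setIntegral_pos_iff_support_of_nonneg_ae (ae_of_all _ fun x => g.nonneg)
        ((hgF.continuousOn.integrableOn_compact hU).mono_set subset_closure)]
      refine ((hgF.isOpen_support).inter hUo).measure_pos _ ⟨x₀, ?_, hx₀⟩
      have : g (F x₀) = 1 :=
        g.one_of_mem_closedBall (Metric.mem_closedBall.2 (hclose x₀ (subset_closure hx₀)).le)
      simp [this]
    have h0 : 0 ≤ ∫ x in U, g (F x) ∂μ := integral_nonneg fun x => g.nonneg
    have h1 : 0 < (brouwerDegree (gradient v) U (gradient v x₀) : ℝ) * ∫ z, g z := by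
      rw [e]; positivity
    have h2 : (0 : ℝ) < brouwerDegree (gradient v) U (gradient v x₀) :=
      (mul_pos_iff_of_pos_right hgpos).1 h1
    exact_mod_cast h2
  · rw [indicator_of_notMem fun h => hyU h.1]
    -- Off the image only nonnegativity is needed, and δ = 0 suffices.
    have e := hformula 0 (fun x hx => by
      rw [hV.rotatedField_zero_eq_gradient hε₀ hx, dist_self]; positivity) g g.contDiff hgs
    have h0 : 0 ≤ (brouwerDegree (gradient v) U y : ℝ) * ∫ z, g z := by
      rw [e, sq, zero_mul, zero_mul, add_zero]
      exact integral_nonneg fun x => g.nonneg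
    have h2 : (0 : ℝ) ≤ brouwerDegree (gradient v) U y := nonneg_of_mul_nonneg_left h0 hgpos
    exact_mod_cast h2

end Formula

/-! ### From the local formula to the integral of the degree -/

/-- A finite measure that integrates smooth functions supported in a ball like `c` times Lebesgue
measure agrees with it on smaller closed balls. -/
theorem restrict_closedBall_eq_of_integral_eq {ν : Measure Plane} [IsFiniteMeasure ν] {y : Plane}
    {η r c : ℝ} (hr : r < η) (hc : 0 ≤ c)
    (h : ∀ g : Plane → ℝ, ContDiff ℝ ∞ g → support g ⊆ Metric.ball y η →
      c * ∫ z, g z = ∫ z, g z ∂ν) :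
    ν.restrict (Metric.closedBall y r)
      = (ENNReal.ofReal c • volume).restrict (Metric.closedBall y r) := by
  have key : ∀ F : Set Plane, IsClosed F → F ⊆ Metric.closedBall y r →
      ν F = ENNReal.ofReal c * volume F := by
    intro F hF hFr
    have hFc : IsCompact F := (isCompact_closedBall y r).of_isClosed_subset hF hFr
    -- Since f equals 1 exactly on F and lies in [0, 1), elsewhere, its powers decrease to the
    -- indicator of F. The exponent n + 1 keeps even the first power supported in the ball.
    obtain ⟨f, hf, hf01, hfs, hf1⟩ := exists_contMDiff_support_eq_eq_one_iff (n := ⊤)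
      (modelWithCornersSelf ℝ Plane) (Metric.isOpen_ball (x := y) (ε := η)) hF
      (hFr.trans (Metric.closedBall_subset_ball hr))
    have hfsm : ContDiff ℝ ∞ f := hf.contDiff
    have h01 : ∀ x, 0 ≤ f x ∧ f x ≤ 1 := fun x => hf01 ⟨x, rfl⟩
    have hlim : ∀ (m : Measure Plane), m (Metric.closedBall y η) < ⊤ → Tendsto
        (fun n : ℕ => ∫ z, f z ^ (n + 1) ∂m) atTop (𝓝 (∫ z, F.indicator (fun _ => (1 : ℝ)) z ∂m)) := by
      intro m hm
      refine tendsto_integral_of_bounded_of_support (M := 1) (isCompact_closedBall y η) hm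
        (fun n => hfsm.continuous.pow _) (fun n x => ?_) (fun n x hx => ?_) fun x => ?_
      · rw [abs_of_nonneg (pow_nonneg (h01 x).1 _)]
        exact pow_le_one₀ (h01 x).1 (h01 x).2
      · have : x ∉ support f := fun hx' => hx (Metric.ball_subset_closedBall (hfs ▸ hx'))
        rw [notMem_support.1 this, zero_pow (by simp)]
      · by_cases hx : x ∈ F
        · simp [indicator_of_mem hx, (hf1 x).1 hx]
        · rw [indicator_of_notMem hx]
          refine (tendsto_pow_atTop_nhds_zero_of_lt_one (h01 x).1 ?_).comp (tendsto_add_atTop_nat 1)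
          exact lt_of_le_of_ne (h01 x).2 fun h => hx ((hf1 x).2 h)
    have h1 := hlim ν (measure_lt_top _ _)
    have h2 := (hlim volume (isCompact_closedBall y η).measure_lt_top).const_mul c
    have h3 : ∀ n : ℕ, c * ∫ z, f z ^ (n + 1) = ∫ z, f z ^ (n + 1) ∂ν := fun n =>
      h _ (hfsm.pow _) fun x hx => hfs ▸ fun hx' => hx (by simp [hx'])
    simp only [h3] at h2
    have h4 := tendsto_nhds_unique h1 h2
    rw [integral_indicator hF.measurableSet, integral_indicator hF.measurableSet] at h4
    simp only [integral_const, smul_eq_mul, mul_one, measureReal_restrict_apply_univ] at h4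
    rw [← ENNReal.toReal_eq_toReal_iff' (measure_ne_top ν F)
      (ENNReal.mul_ne_top ENNReal.ofReal_ne_top hFc.measure_lt_top.ne), ENNReal.toReal_mul,
      ENNReal.toReal_ofReal hc]
    exact h4
  refine ext_of_generate_finite _ (BorelSpace.measurable_eq.trans borel_eq_generateFrom_isClosed)
    isPiSystem_isClosed (fun F hF => ?_) ?_
  · have hF' : IsClosed F := hF
    rw [Measure.restrict_apply hF'.measurableSet, Measure.restrict_apply hF'.measurableSet,
      Measure.smul_apply, smul_eq_mul]
    exact key _ (hF'.inter Metric.isClosed_closedBall) inter_subset_right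
  · rw [Measure.restrict_apply_univ, Measure.restrict_apply_univ, Measure.smul_apply, smul_eq_mul]
    exact key _ Metric.isClosed_closedBall le_rfl

/-- If a nonnegative integer-valued function `d` on an open set `O` represents the finite measure
`ν` locally on smooth functions, then `d` is locally constant and integrates on `O` to `ν O`. -/
theorem integrableOn_and_integral_eq_of_local {d : Plane → ℤ} {O : Set Plane} (hO : IsOpen O)
    (hd : ∀ y ∈ O, 0 ≤ d y) {ν : Measure Plane} [IsFiniteMeasure ν]
    (hloc : ∀ y ∈ O, ∃ η > 0, ∀ g : Plane → ℝ, ContDiff ℝ ∞ g → support g ⊆ Metric.ball y η →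
      (d y : ℝ) * ∫ z, g z = ∫ z, g z ∂ν) :
    IntegrableOn (fun y => (d y : ℝ)) O ∧ ∫ y in O, (d y : ℝ) = ν.real O := by
  choose! η hη hform using hloc
  -- Testing the formulas at y and at z with one common bump forces equal coefficients.
  have hconst : ∀ y ∈ O, ∀ z ∈ O, z ∈ Metric.ball y (η y) → d z = d y := by
    intro y hy z hz hzy
    obtain ⟨r, hr, hball⟩ := Metric.mem_nhds_iff.1
      (inter_mem (Metric.ball_mem_nhds z (hη z hz)) (Metric.isOpen_ball.mem_nhds hzy))
    let g : ContDiffBump z := ⟨r / 2, r, by positivity, by linarith⟩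
    have hgs : support g ⊆ Metric.ball z r := g.support_eq.subset
    have h1 := hform z hz g g.contDiff fun x hx => (hball (hgs hx)).1
    have h2 := hform y hy g g.contDiff fun x hx => (hball (hgs hx)).2
    have h3 : 0 < ∫ z, g z := g.integral_pos
    have h4 := mul_right_cancel₀ h3.ne' (h1.trans h2.symm)
    exact_mod_cast h4
  have hcont : ContinuousOn (fun y => (d y : ℝ)) O := by
    intro y hy
    refine (continuousWithinAt_const (b := (d y : ℝ))).congr_of_eventuallyEq ?_ rfl
    filter_upwards [mem_nhdsWithin_of_mem_nhds (Metric.ball_mem_nhds y (hη y hy)),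
      self_mem_nhdsWithin] with z hz hzO
    rw [hconst y hy z hzO hz]
  let D : Plane → ENNReal := fun y => ENNReal.ofReal (d y)
  have hball : ∀ y ∈ O, ∃ r > 0, Metric.closedBall y r ⊆ O ∧
      ν.restrict (Metric.closedBall y r)
        = (volume.withDensity D).restrict (Metric.closedBall y r) := by
    intro y hy
    obtain ⟨r, hr, hrO⟩ := Metric.nhds_basis_closedBall.mem_iff.1
      (inter_mem (hO.mem_nhds hy) (Metric.ball_mem_nhds y (hη y hy)))
    refine ⟨min r (η y / 2), lt_min hr (by have := hη y hy; positivity),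
      (Metric.closedBall_subset_closedBall (min_le_left _ _)).trans (hrO.trans inter_subset_left), ?_⟩
    rw [restrict_closedBall_eq_of_integral_eq (c := d y) (η := η y)
      (lt_of_le_of_lt (min_le_right _ _) (by linarith [hη y hy])) (by exact_mod_cast hd y hy)
      (hform y hy), restrict_withDensity measurableSet_closedBall, Measure.restrict_smul,
      ← withDensity_const]
    refine withDensity_congr_ae ?_
    filter_upwards [ae_restrict_mem measurableSet_closedBall] with z hz
    have hz' := hrO (Metric.closedBall_subset_closedBall (min_le_left _ _) hz)
    simp only [D, hconst y hy z hz'.1 hz'.2]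
  choose! r hr hrO hrest using hball
  -- Lindelöf: countably many balls cover O, so the local equalities of measures glue to all of O.
  obtain ⟨t, htO, htc, hOt⟩ := TopologicalSpace.countable_cover_nhdsWithin
    (f := fun y => Metric.closedBall y (r y)) (s := O) fun y hy =>
      mem_nhdsWithin_of_mem_nhds (Metric.closedBall_mem_nhds y (hr y hy))
  have hOeq : O = ⋃ y ∈ t, Metric.closedBall y (r y) :=
    hOt.antisymm (iUnion₂_subset fun y hy => hrO y (htO hy))
  have hall : ν.restrict O = (volume.withDensity D).restrict O := by
    rw [hOeq, Measure.restrict_biUnion_congr htc]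
    exact fun y hy => hrest y (htO hy)
  have hlint : ∫⁻ y in O, D y = ν O := by
    rw [← withDensity_apply _ hO.measurableSet, ← Measure.restrict_apply_self _ O, ← hall,
      Measure.restrict_apply_self]
  have hae : 0 ≤ᵐ[volume.restrict O] fun y => (d y : ℝ) := by
    filter_upwards [ae_restrict_mem hO.measurableSet] with y hy
    have : (0 : ℝ) ≤ d y := by exact_mod_cast hd y hy
    exact this
  have hm := hcont.aestronglyMeasurable (μ := volume) hO.measurableSet
  refine ⟨⟨hm, ?_⟩, ?_⟩
  · rw [hasFiniteIntegral_iff_ofReal hae]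
    exact hlint.trans_lt (measure_lt_top _ _)
  · rw [integral_eq_lintegral_of_nonneg_ae hae hm]
    exact congrArg ENNReal.toReal hlint

/-! ### The main theorem -/

theorem mainTheorem5 (α : ℝ≥0) (hα : 2 / 3 < α) (hα' : α ≤ 1)
    (Ω : Opens Plane) (U : Set Plane) (hU : IsOpen U) (hUΩ : CompactlyContained U Ω)
    (v : Plane → ℝ) (hv : IsC1Holder α v Ω)
    (hf : DistributionNonneg (veryWeakHessianDet Ω v)) :
    IsInducedMeasure (veryWeakHessianDet Ω v) (inducedMeasure (veryWeakHessianDet Ω v)) ∧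
    (∀ y ∉ gradient v '' frontier U,
      (gradient v '' U \ gradient v '' frontier U).indicator (fun _ => (1 : ℤ)) y
        ≤ brouwerDegree (gradient v) U y) ∧
    IntegrableOn (fun y => (brouwerDegree (gradient v) U y : ℝ))
      (gradient v '' frontier U)ᶜ volume ∧
    ∫ y in (gradient v '' frontier U)ᶜ, (brouwerDegree (gradient v) U y : ℝ)
      ≤ (inducedMeasure (veryWeakHessianDet Ω v)).real U := by
  have hμ := hf.isInducedMeasure_inducedMeasure
  refine ⟨hμ, ?_⟩
  rcases U.eq_empty_or_nonempty with rfl | hne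
  · simp [brouwerDegree_empty]
  set μ := inducedMeasure (veryWeakHessianDet Ω v)
  obtain ⟨V, K, ε₀, H, hε₀, hH, hKΩ, hV⟩ := hv.exists_isLocalPotential hUΩ
  have hc := hv.continuousOn_gradient
  have hα₀ : (2 / 3 : ℝ) < α := by exact_mod_cast hα
  have hi : ∀ y ∉ gradient v '' frontier U,
      (gradient v '' U \ gradient v '' frontier U).indicator (fun _ => (1 : ℤ)) y
        ≤ brouwerDegree (gradient v) U y := fun y hy =>
    hV.indicator_le_brouwerDegree hc hε₀ hH hα₀ hKΩ hU hUΩ.1 hUΩ.2 hne hμ hy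
  refine ⟨hi, ?_⟩
  set F := rotatedField (pderivPlane 0 V) (pderivPlane 1 V) 0 with hF
  have hFc : Continuous F := hV.continuous_rotatedField 0
  have hμU : μ U < ⊤ := (measure_mono subset_closure).trans_lt
    (hμ.lt_top_of_isCompact _ hUΩ.1 hUΩ.2)
  have : IsFiniteMeasure (μ.restrict U) := ⟨by rwa [Measure.restrict_apply_univ]⟩
  have hO : IsOpen (gradient v '' frontier U)ᶜ :=
    ((hUΩ.1.of_isClosed_subset isClosed_frontier frontier_subset_closure).image_of_continuousOn
      (hc.mono (frontier_subset_closure.trans hUΩ.2))).isClosed.isOpen_compl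
  -- F agrees with ∇v on the closure of U and is continuous on the whole plane, so the push-forward
  -- under F behaves well even though ∇v is controlled only on Ω.
  obtain ⟨h1, h2⟩ := integrableOn_and_integral_eq_of_local
    (d := brouwerDegree (gradient v) U) (ν := (μ.restrict U).map F) hO
    (fun y hy => (indicator_nonneg (fun _ _ => zero_le_one) y).trans (hi y hy)) fun y hy => by
      obtain ⟨η, hη, hform⟩ := hV.exists_degree_formula hc hε₀ hH hα₀ hKΩ hU hUΩ.1 hUΩ.2 hne hμ hy
      refine ⟨η, hη, fun g hg hgs => ?_⟩
      rw [integral_map hFc.aemeasurable hg.continuous.aestronglyMeasurable,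
        hform 0 (fun x hx => ?_) g hg hgs]
      · simp [hF]
      · rw [hV.rotatedField_zero_eq_gradient hε₀ hx, dist_self]
        positivity
  refine ⟨h1, h2.trans_le ?_⟩
  -- The inequality discards only the μ-mass of points of U that ∇v sends into ∇v(∂U).
  refine ENNReal.toReal_mono hμU.ne ?_
  rw [Measure.map_apply hFc.measurable hO.measurableSet]
  exact (measure_mono (subset_univ _)).trans (Measure.restrict_apply_univ U).le
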